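/- Let $n\ge 3$ be an integer, let $A=(a_1,\dots,a_n)$ be a sequence of positive integers, and let $0<\theta_1<\dots<\theta_n<\pi$. Put $\Pi=\prod_{i=1}^n\{0,\dots,a_i\}\subset\mathbb Z^n$, let $C=\prod_{i=1}^n[0,a_i]$ be the cubical complex with vertex set $\Pi$ (its faces are the faces of the unit cubes with vertices in $\Pi$), let $\pi:C\to\mathbb R^2$ be the map $\pi(x_1,\dots,x_n)=\sum_i x_i(\cos\theta_i,\sin\theta_i)$, and let $P=\pi(C)$. A tiling of $P$ is a two-dimensional subcomplex $T\subset C$ such that $\pi$ restricts to a homeomorphism $T\to P$; its set of vertices is denoted $\mathrm{vert}(T)\subset\Pi$. Write $e_1,\dots,e_n$ for the standard basis of $\mathbb Z^n$. Let $T_0$ be a tiling of $P$, and let $x_J$, $J\in\mathrm{vert}(T_0)$, be formal variables. Then there is exactly one way to extend $\{x_J\}_{J\in\mathrm{vert}(T_0)}$ to a labeling $\{x_I\}_{I\in\Pi}$ of all of $\Pi$ by elements of the field $\mathbb Q(\{x_J\}_{J\in\mathrm{vert}(T_0)})$ such that the multidimensional cube recurrence $$x_{I+e_j+e_\ell}\,x_{I+e_k}=x_I\,x_{I+e_j+e_k+e_\ell}+x_{I+e_j+e_k}\,x_{I+e_\ell}+x_{I+e_k+e_\ell}\,x_{I+e_j}$$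 holds for all $1\le j<k<\ell\le n$ and all $I$ such that $I$ and $I+e_j+e_k+e_\ell$ both lie in $\Pi$. Moreover, for every $I\in\Pi$ the value $x_I$ is a Laurent polynomial in the variables $\{x_J\}_{J\in\mathrm{vert}(T_0)}$, that is, $x_I\in\mathbb Q[x_J,x_J^{-1}]_{J\in\mathrm{vert}(T_0)}$. -/

import Mathlib

/-!
Rhombus tilings of a zonogon, regarded as sections of the projection of a box with its unit
cubical structure to the plane, and the multidimensional cube recurrence.
-/

namespace CubeRecurrence

/-- The `i`-th standard basis vector of the lattice. -/
def e {n : ℕ} (i : Fin n) : Fin n → ℕ := Pi.single i 1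

/-- A (closed) face of the cubical complex `C(A) = ∏ [0, a_i]` with vertex set
`Π(A) = ∏ {0, …, a_i} = {I | I ≤ a}`: its lowest vertex `base`, and the set `dirs` of the
directions it spans.  Its dimension is the cardinality of `dirs`. -/
structure Face {n : ℕ} (a : Fin n → ℕ) where
  base : Fin n → ℕ
  dirs : Finset (Fin n)
  le : ∀ i, base i + (if i ∈ dirs then 1 else 0) ≤ a i

/-- The points of a face: unit interval `[base i, base i + 1]` in the spanned directions,
the single value `base i` in the others. -/
def Face.carrier {n : ℕ} {a : Fin n → ℕ} (F : Face a) : Set (Fin n → ℝ) :=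
  {x | ∀ i, (F.base i : ℝ) ≤ x i ∧ x i ≤ (F.base i : ℝ) + (if i ∈ F.dirs then 1 else 0)}

/-- A subcomplex of `C(A)`: a set of faces that contains all faces of its members. -/
structure Subcomplex {n : ℕ} (a : Fin n → ℕ) where
  faces : Set (Face a)
  down_closed : ∀ F ∈ faces, ∀ G : Face a, G.carrier ⊆ F.carrier → G ∈ faces

/-- The underlying space of a subcomplex. -/
def Subcomplex.support {n : ℕ} {a : Fin n → ℕ} (T : Subcomplex a) : Set (Fin n → ℝ) :=
  ⋃ F ∈ T.faces, F.carrier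

/-- The vertices of a subcomplex. -/
def Subcomplex.vert {n : ℕ} {a : Fin n → ℕ} (T : Subcomplex a) : Set (Fin n → ℕ) :=
  {I | ∃ F ∈ T.faces, F.dirs = ∅ ∧ F.base = I}

/-- The projection `x ↦ ∑ x_i v_i` to the plane, where `v_i = (cos θ_i, sin θ_i)`. -/
noncomputable def proj {n : ℕ} (θ : Fin n → ℝ) (x : Fin n → ℝ) : ℝ × ℝ :=
  (∑ i, x i * Real.cos (θ i), ∑ i, x i * Real.sin (θ i))

/-- The zonogon `P`, the image of `∏ [0, a_i]` under the projection. -/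
def zonogon {n : ℕ} (a : Fin n → ℕ) (θ : Fin n → ℝ) : Set (ℝ × ℝ) :=
  proj θ '' Set.Icc 0 (fun i => (a i : ℝ))

/-- A tiling: a two-dimensional subcomplex of `C(A)` which the projection maps
homeomorphically onto the zonogon `P`.  (That there are faces of dimension two, and not only
faces of dimension at most two, follows as `P` has interior points.) -/
def Subcomplex.IsTiling {n : ℕ} {a : Fin n → ℕ} (T : Subcomplex a) (θ : Fin n → ℝ) : Prop :=
  (∀ F ∈ T.faces, F.dirs.card ≤ 2) ∧
    ∃ φ : ↥T.support ≃ₜ ↥(zonogon a θ), ∀ p : ↥T.support, (φ p : ℝ × ℝ) = proj θ p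

/-- The relations of the multidimensional cube recurrence, for a labeling of the points
`I ≤ a`.  The values of `x` at other points are irrelevant. -/
def CubeRelations {n : ℕ} {K : Type*} [Field K] (a : Fin n → ℕ) (x : (Fin n → ℕ) → K) : Prop :=
  ∀ (I : Fin n → ℕ) (j k l : Fin n), j < k → k < l → I + e j + e k + e l ≤ a →
    x (I + e j + e l) * x (I + e k) =
      x I * x (I + e j + e k + e l) + x (I + e j + e k) * x (I + e l)
        + x (I + e k + e l) * x (I + e j)

/-- The field `ℚ({x_J}_{J ∈ vert T})` of rational functions in one formal variable for each
vertex of `T`. -/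
abbrev Subcomplex.RatFunc {n : ℕ} {a : Fin n → ℕ} (T : Subcomplex a) : Type :=
  FractionRing (MvPolynomial ↥T.vert ℚ)

/-- The formal variable `x_J`, as an element of the field of rational functions. -/
noncomputable def Subcomplex.var {n : ℕ} {a : Fin n → ℕ} (T : Subcomplex a) (J : ↥T.vert) :
    T.RatFunc :=
  algebraMap (MvPolynomial ↥T.vert ℚ) T.RatFunc (MvPolynomial.X J)

/-- The ring `ℚ[x_J, x_J⁻¹]_{J ∈ vert T}` of Laurent polynomials, inside the field of rational
functions. -/
noncomputable def Subcomplex.laurent {n : ℕ} {a : Fin n → ℕ} (T : Subcomplex a) :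
    Subalgebra ℚ T.RatFunc :=
  Algebra.adjoin ℚ (Set.range T.var ∪ Set.range (fun J => (T.var J)⁻¹))

/-- `x` is a labeling of the points `I ≤ a` by rational functions which extends the labeling
of the vertices of `T` by their formal variables and satisfies the cube recurrence. -/
def Subcomplex.IsLabeling {n : ℕ} {a : Fin n → ℕ} (T : Subcomplex a)
    (x : (Fin n → ℕ) → T.RatFunc) : Prop :=
  (∀ J : ↥T.vert, x J = T.var J) ∧ CubeRelations a x

end CubeRecurrence

/-! A lattice path in a box is a word in the directions, and swapping an ascent `j < k` moves it
left across a parallelogram, replacing the right vertex `I + e j` by the left vertex `I + e k`.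
Lifting short leftward horizontal segments through the inverse homeomorphism finds the rhombi of a
tiling to the left of its vertices and edges. Injectivity makes a rhombus determined by its right
vertex, and also by its left one. Hence the sorted path (right boundary) can be swept across all
vertices of the tiling to the antisorted path (left boundary), one rhombus at a time:
`Subcomplex.IsTiling.exists_sweep`.

Existence and the Laurent property come together. Encode lattice points as subsets of a finite
ordered set and seek a function on subsets satisfying the quadratic relations `IsPure`. Unit values
along one path are interpolated by a monomial, which is pure. At each swap a transvection `1 + t
ψ_q† ψ_p` preserves purity, leaves the values at visited points alone and adjusts the value at the
new point; solving for `t` only divides by the value at the replaced vertex. Thus any unit values on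
the vertices extend over the same ring. Purity contains a four-term relation (`IsPure.four_term`)
that becomes the cube recurrence after a sign change depending on the coordinate sum. Taking the
Laurent polynomial ring as the ring makes every value Laurent.

For uniqueness, consider the points where a second labeling agrees with the constructed one and the
value is positive, as a quotient of polynomials positive at `(1, …, 1)`. Positivity permits division
in the recurrence, so this set is closed under passing between the two middle points of a cube. It
contains the sweep. By a diamond argument in the weak order (`Good.of_step`) every path from `0` to
`a`, hence every point of the box, is reached. -/

namespace CubeRecurrence

/-! ### Fermionic operators, pure spinors and the four-term relation. -/

section Spinor

variable {E : Type*} [LinearOrder E] {R : Type*} [CommRing R]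

/-- The Jordan–Wigner sign `(-1) ^ #{s ∈ S | s < i}`. -/
def jwSign (R : Type*) [CommRing R] (i : E) (S : Finset E) : R :=
  ∏ s ∈ S, if s < i then -1 else 1

/-- The fermionic creation operator. -/
def create (i : E) (X : Finset E → R) (S : Finset E) : R :=
  if i ∈ S then jwSign R i S * X (S.erase i) else 0

/-- The fermionic annihilation operator. -/
def annihilate (i : E) (X : Finset E → R) (S : Finset E) : R :=
  if i ∈ S then 0 else jwSign R i S * X (insert i S)

theorem jwSign_insert {i j : E} {S : Finset E} (hj : j ∉ S) :
    jwSign R i (insert j S) = (if j < i then -1 else 1) * jwSign R i S := by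
  simp [jwSign, Finset.prod_insert hj]

theorem jwSign_erase {i j : E} {S : Finset E} (hj : j ∈ S) :
    jwSign R i (S.erase j) = (if j < i then -1 else 1) * jwSign R i S := by
  rw [← Finset.insert_erase hj, jwSign_insert (Finset.notMem_erase j S), Finset.insert_erase hj]
  split_ifs <;> simp

theorem jwSign_mul_self (i : E) (S : Finset E) : jwSign R i S * jwSign R i S = 1 := by
  rw [jwSign, ← Finset.prod_mul_distrib]
  refine Finset.prod_eq_one fun s _ => ?_
  split_ifs <;> simp

/-- Clifford relations. Inserting or deleting the smaller of two indices flips the sign attached to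
the larger, but not conversely, so exchanging two operators costs exactly one sign. -/
theorem create_create (i j : E) (X : Finset E → R) (S : Finset E) :
    create i (create j X) S = -create j (create i X) S := by
  rcases lt_trichotomy i j with h | rfl | h
  · by_cases hi : i ∈ S <;> by_cases hj : j ∈ S <;>
      simp [create, hi, hj, h.ne, h.ne', jwSign_erase, h, h.not_gt, Finset.erase_right_comm]
    ring
  · by_cases hi : i ∈ S <;> simp [create, hi]
  · by_cases hi : i ∈ S <;> by_cases hj : j ∈ S <;>
      simp [create, hi, hj, h.ne, h.ne', jwSign_erase, h, h.not_gt, Finset.erase_right_comm]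
    ring

theorem annihilate_annihilate (i j : E) (X : Finset E → R) (S : Finset E) :
    annihilate i (annihilate j X) S = -annihilate j (annihilate i X) S := by
  rcases lt_trichotomy i j with h | rfl | h
  · by_cases hi : i ∈ S <;> by_cases hj : j ∈ S <;>
      simp [annihilate, hi, hj, h.ne, h.ne', jwSign_insert, h, h.not_gt, Finset.insert_comm i j]
    ring
  · by_cases hi : i ∈ S <;> simp [annihilate, hi]
  · by_cases hi : i ∈ S <;> by_cases hj : j ∈ S <;>
      simp [annihilate, hi, hj, h.ne, h.ne', jwSign_insert, h, h.not_gt, Finset.insert_comm i j]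
    ring

theorem create_annihilate {i j : E} (hij : i ≠ j) (X : Finset E → R) (S : Finset E) :
    create i (annihilate j X) S = -annihilate j (create i X) S := by
  rcases lt_or_gt_of_ne hij with h | h
  · by_cases hi : i ∈ S <;> by_cases hj : j ∈ S <;>
      simp [create, annihilate, hi, hj, h.ne, h.ne', jwSign_insert, jwSign_erase, h, h.not_gt,
        Finset.erase_insert_of_ne]
    ring
  · by_cases hi : i ∈ S <;> by_cases hj : j ∈ S <;>
      simp [create, annihilate, hi, hj, h.ne, h.ne', jwSign_insert, jwSign_erase, h, h.not_gt,
        Finset.erase_insert_of_ne]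
    ring

theorem create_annihilate_self (i : E) (X : Finset E → R) (S : Finset E) :
    create i (annihilate i X) S + annihilate i (create i X) S = X S := by
  by_cases hi : i ∈ S
  · simp [create, annihilate, hi, jwSign_erase, ← mul_assoc, jwSign_mul_self]
  · simp [create, annihilate, hi, jwSign_insert, ← mul_assoc, jwSign_mul_self]

theorem create_neg (i : E) (X : Finset E → R) : create i (-X) = -create i X := by
  funext S; by_cases hi : i ∈ S <;> simp [create, hi]

theorem create_sub (i : E) (X Y : Finset E → R) :
    create i (X - Y) = create i X - create i Y := by
  funext S; by_cases hi : i ∈ S <;> simp [create, hi]; ring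

/-- The unipotent transformation `1 + t ψ_q† ψ_p`. -/
def transvect (p q : E) (t : R) (X : Finset E → R) (S : Finset E) : R :=
  X S + t * create q (annihilate p X) S

/-- Moving `ψ_i†` past two operators produces two cancelling signs; the only correction is the
contraction with `ψ_p`, present when `i = p`. -/
theorem create_transvect_aux (i p q : E) (X : Finset E → R) (S : Finset E) :
    create i (create q (annihilate p X)) S =
      create q (annihilate p (create i X)) S - if i = p then create q X S else 0 := by
  rw [create_create]
  by_cases h : i = p
  · subst h
    have : create i (annihilate i X) = X - annihilate i (create i X) := by
      funext T; simp [← create_annihilate_self i X T]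
    rw [this, create_sub]; simp
  · have : create i (annihilate p X) = -annihilate p (create i X) := by
      funext T; simp [create_annihilate h]
    rw [this, create_neg]; simp [h]

theorem annihilate_transvect_aux (i p q : E) (X : Finset E → R) (S : Finset E) :
    annihilate i (create q (annihilate p X)) S =
      create q (annihilate p (annihilate i X)) S + if i = q then annihilate p X S else 0 := by
  have h2 : annihilate i (annihilate p X) = -annihilate p (annihilate i X) := by
    funext T; simp [annihilate_annihilate i p]
  by_cases h : i = q
  · subst h
    have := create_annihilate_self i (annihilate p X) S
    rw [h2, create_neg, Pi.neg_apply] at this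
    simp [← this]
  · have := create_annihilate (Ne.symm h) (annihilate p X) S
    rw [h2, create_neg] at this
    simp only [Pi.neg_apply, neg_inj] at this
    simp [h, this]

theorem create_transvect (i p q : E) (t : R) (X : Finset E → R) (S : Finset E) :
    create i (transvect p q t X) S =
      transvect p q t (create i X) S - if i = p then t * create q X S else 0 := by
  have h := create_transvect_aux i p q X S
  have : create i (transvect p q t X) S =
      create i X S + t * create i (create q (annihilate p X)) S := by
    by_cases hi : i ∈ S
    · simp only [create, transvect, hi, if_true]; ring
    · simp [create, hi]
  rw [this, h, transvect]
  split_ifs <;> ring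

theorem annihilate_transvect (i p q : E) (t : R) (X : Finset E → R) (S : Finset E) :
    annihilate i (transvect p q t X) S =
      transvect p q t (annihilate i X) S + if i = q then t * annihilate p X S else 0 := by
  have h := annihilate_transvect_aux i p q X S
  have : annihilate i (transvect p q t X) S =
      annihilate i X S + t * annihilate i (create q (annihilate p X)) S := by
    by_cases hi : i ∈ S
    · simp [annihilate, hi]
    · simp only [annihilate, transvect, hi, if_false]; ring
  rw [this, h, transvect]
  split_ifs <;> ring

/-- At a fixed argument, `ψ_q† ψ_p` is evaluation at a set of the same size, up to a scalar. -/
theorem exists_create_annihilate_eq {p q : E} (hpq : p ≠ q) (S : Finset E) :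
    ∃ (σ : R) (S' : Finset E), S'.card = S.card ∧
      ∀ X : Finset E → R, create q (annihilate p X) S = σ * X S' := by
  by_cases hq : q ∈ S
  · by_cases hp : p ∈ S
    · exact ⟨0, S, rfl, fun X => by simp [create, annihilate, hp, hpq]⟩
    · refine ⟨jwSign R q S * jwSign R p (S.erase q), insert p (S.erase q), ?_, fun X => ?_⟩
      · rw [Finset.card_insert_of_notMem (by simp [hp]), Finset.card_erase_add_one hq]
      · simp [create, annihilate, hq, hp, mul_assoc]
  · exact ⟨0, S, rfl, fun X => by simp [create, hq]⟩

/-- A signed count of the elements of `S`. -/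
theorem sum_jwSign (S : Finset E) :
    ∑ i ∈ S, jwSign R i S = if Odd S.card then 1 else 0 := by
  induction S using Finset.induction_on_max with
  | empty => simp
  | insert a S ha ih =>
    have hS : a ∉ S := fun h => lt_irrefl a (ha a h)
    have h1 : ∀ i ∈ S, jwSign R i (insert a S) = jwSign R i S := fun i hi => by
      rw [jwSign_insert hS, if_neg (ha i hi).not_gt, one_mul]
    have h2 : jwSign R a (insert a S) = (-1) ^ S.card := by
      rw [jwSign_insert hS, if_neg (lt_irrefl a), one_mul, jwSign,
        Finset.prod_congr rfl fun s hs => if_pos (ha s hs), Finset.prod_const]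
    rw [Finset.sum_insert hS, Finset.sum_congr rfl h1, ih, h2, Finset.card_insert_of_notMem hS]
    by_cases h : Odd S.card
    · simp [Nat.odd_add_one, h]
    · simp [Nat.odd_add_one, h, (Nat.not_odd_iff_even.1 h).neg_one_pow]

/-- Elements common to both sets contribute squares of signs. -/
theorem jwSign_mul_jwSign (i : E) (S T : Finset E) :
    jwSign R i S * jwSign R i T = jwSign R i (symmDiff S T) := by
  have h1 : jwSign R i (S ∩ T) * jwSign R i (S ∩ T) = 1 := jwSign_mul_self i _
  have h2 : jwSign R i S = jwSign R i (S \ T) * jwSign R i (S ∩ T) := by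
    rw [jwSign, jwSign, jwSign, ← Finset.prod_union (Finset.disjoint_sdiff_inter S T),
      Finset.sdiff_union_inter]
  have h3 : jwSign R i T = jwSign R i (T \ S) * jwSign R i (S ∩ T) := by
    rw [jwSign, jwSign, jwSign, Finset.inter_comm,
      ← Finset.prod_union (Finset.disjoint_sdiff_inter T S), Finset.sdiff_union_inter]
  have h4 : jwSign R i (symmDiff S T) = jwSign R i (S \ T) * jwSign R i (T \ S) := by
    rw [jwSign, jwSign, jwSign, symmDiff, Finset.sup_eq_union,
      Finset.prod_union disjoint_sdiff_sdiff]
  rw [h2, h3, h4]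
  linear_combination jwSign R i (S \ T) * jwSign R i (T \ S) * h1

variable [Fintype E]

/-- The quadratic relations of spinor varieties. -/
def IsPure (X : Finset E → R) : Prop :=
  ∀ S T : Finset E, Odd (S.card + T.card) →
    ∑ i, (create i X S * annihilate i X T + annihilate i X S * create i X T) = X S * X T

/-- The two corrections sit at different indices, so no product of corrections appears. -/
theorem sum_perturbed_mul {p q : E} (hpq : p ≠ q) (f h : E → R) (x y : R) :
    ∑ i, (f i - if i = p then x else 0) * (h i + if i = q then y else 0) =
      ∑ i, f i * h i + f q * y - x * h p := by
  have : ∀ i, (f i - if i = p then x else 0) * (h i + if i = q then y else 0) =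
      f i * h i + (if i = q then f i * y else 0) - if i = p then x * h i else 0 := by
    intro i
    by_cases h1 : i = p
    · subst h1; simp [hpq]; ring
    · by_cases h2 : i = q
      · subst h2; simp [hpq.symm, mul_add]
      · simp [h1, h2]
  simp [Finset.sum_congr rfl fun i _ => this i, Finset.sum_add_distrib, Finset.sum_sub_distrib]

/-- The transvection lies in the group preserving the quadratic form behind purity. At fixed
arguments it is `X S + t σ X S'`, so the relation expands bilinearly into four instances of the old
one, while the commutator corrections cancel. -/
theorem IsPure.transvect {X : Finset E → R} (hX : IsPure X) {p q : E} (hpq : p ≠ q) (t : R) :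
    IsPure (transvect p q t X) := by
  intro S T hST
  obtain ⟨σ, S', hS', hσ⟩ := exists_create_annihilate_eq (R := R) hpq S
  obtain ⟨τ, T', hT', hτ⟩ := exists_create_annihilate_eq (R := R) hpq T
  -- This and the next three hold because `ψ_q†` and `ψ_p` square to zero and anticommute with each
  -- other.
  have hcS : σ * create q X S' = 0 := by
    rw [← hσ]; simp [create, annihilate, hpq.symm]
  have hcT : τ * create q X T' = 0 := by
    rw [← hτ]; simp [create, annihilate, hpq.symm]
  have hdS : σ * annihilate p X S' = 0 := by
    rw [← hσ]; simp [create, annihilate]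
  have hdT : τ * annihilate p X T' = 0 := by
    rw [← hτ]; simp [create, annihilate]
  have h1 := hX S T hST
  have h2 := hX S' T (by rwa [hS'])
  have h3 := hX S T' (by rwa [hT'])
  have h4 := hX S' T' (by rwa [hS', hT'])
  simp only [create_transvect, annihilate_transvect]
  rw [Finset.sum_add_distrib, sum_perturbed_mul hpq]
  have hc : ∑ i, (CubeRecurrence.transvect p q t (annihilate i X) S +
        if i = q then t * annihilate p X S else 0) *
      (CubeRecurrence.transvect p q t (create i X) T - if i = p then t * create q X T else 0) =
      ∑ i, (CubeRecurrence.transvect p q t (create i X) T -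
        if i = p then t * create q X T else 0) *
        (CubeRecurrence.transvect p q t (annihilate i X) S +
          if i = q then t * annihilate p X S else 0) :=
    Finset.sum_congr rfl fun i _ => mul_comm _ _
  rw [hc, sum_perturbed_mul hpq]
  simp only [CubeRecurrence.transvect, hσ, hτ, hcS, hcT, hdS, hdT]
  have e1 : (X S + t * (σ * X S')) * (X T + t * (τ * X T')) =
      X S * X T + t * σ * (X S' * X T) + t * τ * (X S * X T') + t * t * σ * τ * (X S' * X T') := by
    ring
  have e2 : ∑ i, (create i X S + t * (σ * create i X S')) *
        (annihilate i X T + t * (τ * annihilate i X T')) +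
      ∑ i, (create i X T + t * (τ * create i X T')) *
        (annihilate i X S + t * (σ * annihilate i X S')) =
      (X S + t * (σ * X S')) * (X T + t * (τ * X T')) := by
    rw [e1, ← h1, ← h2, ← h3, ← h4]
    simp only [Finset.mul_sum, ← Finset.sum_add_distrib]
    exact Finset.sum_congr rfl fun i _ => by ring
  -- In each half of the sum, the corrections from `i = p` and `i = q` are the same product with
  -- opposite signs.
  rw [← e2]
  ring

/-- Monomials are pure spinors. -/
theorem isPure_prod (c : R) (ρ : E → R) : IsPure fun S => c * ∏ s ∈ S, ρ s := by
  intro S T hST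
  have hodd : Odd (symmDiff S T).card := by
    have h1 := Finset.card_sdiff_add_card_inter S T
    have h2 := Finset.card_sdiff_add_card_inter T S
    rw [Finset.inter_comm] at h2
    rw [symmDiff, Finset.sup_eq_union, Finset.card_union_of_disjoint disjoint_sdiff_sdiff]
    rw [Nat.odd_iff] at hST ⊢
    omega
  have key : ∀ i, create i (fun S => c * ∏ s ∈ S, ρ s) S *
        annihilate i (fun S => c * ∏ s ∈ S, ρ s) T +
      annihilate i (fun S => c * ∏ s ∈ S, ρ s) S * create i (fun S => c * ∏ s ∈ S, ρ s) T =
      (if i ∈ symmDiff S T then jwSign R i (symmDiff S T) else 0) *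
        ((c * ∏ s ∈ S, ρ s) * (c * ∏ s ∈ T, ρ s)) := by
    intro i
    rw [← jwSign_mul_jwSign]
    by_cases hS : i ∈ S <;> by_cases hT : i ∈ T
    · simp [create, annihilate, hS, hT, Finset.mem_symmDiff]
    · simp [create, annihilate, hS, hT, Finset.mem_symmDiff, ← Finset.mul_prod_erase S ρ hS]
      ring
    · simp [create, annihilate, hS, hT, Finset.mem_symmDiff, ← Finset.mul_prod_erase T ρ hT]
      ring
    · simp [create, annihilate, hS, hT, Finset.mem_symmDiff]
  -- The signs alternate along the symmetric difference, which has odd size, so they add up to `1`.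
  rw [Finset.sum_congr rfl fun i _ => key i, ← Finset.sum_mul, Finset.sum_ite_mem,
    Finset.univ_inter, sum_jwSign, if_pos hodd, one_mul]

/-- The four-term Pfaffian relation. -/
theorem IsPure.four_term {X : Finset E → R} (hX : IsPure X) {p q r : E} (hpq : p < q)
    (hqr : q < r) {S : Finset E} (hp : p ∉ S) (hq : q ∉ S) (hr : r ∉ S) :
    X (insert q S) * X (insert r (insert p S)) =
      X (insert p S) * X (insert r (insert q S)) + X (insert r S) * X (insert q (insert p S)) -
        X S * X (insert r (insert q (insert p S))) := by
  have hpr := hpq.trans hqr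
  have hq' : q ∉ insert p S := by simp [hq, hpq.ne']
  have hr' : r ∉ insert q (insert p S) := by simp [hr, hpr.ne', hqr.ne']
  have h := hX S (insert r (insert q (insert p S))) (by
    rw [Finset.card_insert_of_notMem hr', Finset.card_insert_of_notMem hq',
      Finset.card_insert_of_notMem hp, Nat.odd_iff]
    omega)
  -- An index in both sets or in neither contributes nothing, leaving `p`, `q` and `r`.
  have key : ∀ i, create i X S * annihilate i X (insert r (insert q (insert p S))) +
      annihilate i X S * create i X (insert r (insert q (insert p S))) =
      if i ∈ insert r (insert q ({p} : Finset E)) then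
        jwSign R i (insert r (insert q (insert p S))) * jwSign R i S * (X (insert i S) *
          X ((insert r (insert q (insert p S))).erase i)) else 0 := by
    intro i
    by_cases hS : i ∈ S
    · have h1 : i ≠ p := fun h => hp (h ▸ hS)
      have h2 : i ≠ q := fun h => hq (h ▸ hS)
      have h3 : i ≠ r := fun h => hr (h ▸ hS)
      simp [annihilate, hS, h1, h2, h3]
    · by_cases h1 : i ∈ insert r (insert q ({p} : Finset E))
      · have h2 : i ∈ insert r (insert q (insert p S)) := by
          simp only [Finset.mem_insert, Finset.mem_singleton] at h1 ⊢; tauto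
        simp only [create, annihilate, hS, h1, h2, if_true, if_false]; ring
      · have h2 : i ∉ insert r (insert q (insert p S)) := by
          simp only [Finset.mem_insert, Finset.mem_singleton] at h1 ⊢; tauto
        simp only [create, hS, h1, h2, if_false]; ring
  rw [Finset.sum_congr rfl fun i _ => key i, Finset.sum_ite_mem, Finset.univ_inter,
    Finset.sum_insert (by simp [hqr.ne', hpr.ne']), Finset.sum_insert (by simp [hpq.ne']),
    Finset.sum_singleton] at h
  have er : (insert r (insert q (insert p S))).erase r = insert q (insert p S) :=
    Finset.erase_insert hr'
  have eq : (insert r (insert q (insert p S))).erase q = insert r (insert p S) := by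
    rw [Finset.insert_comm r q, Finset.erase_insert (by simp [hq, hpq.ne', hqr.ne])]
  have ep : (insert r (insert q (insert p S))).erase p = insert r (insert q S) := by
    rw [Finset.insert_comm q p, Finset.insert_comm r p,
      Finset.erase_insert (by simp [hp, hpq.ne, hpr.ne])]
  rw [er, eq, ep] at h
  simp only [jwSign_insert hr', jwSign_insert hq', jwSign_insert hp, hpq, hqr, hpr, hpq.not_gt,
    hqr.not_gt, hpr.not_gt, lt_irrefl, if_true, if_false, mul_assoc, one_mul] at h
  have sp := jwSign_mul_self (R := R) p S
  have sq := jwSign_mul_self (R := R) q S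
  have sr := jwSign_mul_self (R := R) r S
  linear_combination (-1 : R) * h + (X (insert r S) * X (insert q (insert p S))) * sr -
    (X (insert q S) * X (insert r (insert p S))) * sq +
    (X (insert p S) * X (insert r (insert q S))) * sp

end Spinor

/-! ### Lattice paths as words, the weak order, and sweeps. -/

section Words

variable {n : ℕ}

/-- The endpoint of the lattice path with steps `w`. -/
def cnt (w : List (Fin n)) : Fin n → ℕ := fun i => w.count i

theorem cnt_nil : cnt ([] : List (Fin n)) = 0 := by funext i; simp [cnt]

theorem cnt_append (u v : List (Fin n)) : cnt (u ++ v) = cnt u + cnt v := by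
  funext i; simp [cnt]

theorem cnt_cons (j : Fin n) (v : List (Fin n)) : cnt (j :: v) = e j + cnt v := by
  funext i
  rcases eq_or_ne i j with rfl | h
  · simp [cnt, e, add_comm]
  · simp [cnt, e, h, h.symm]

theorem cnt_concat (u : List (Fin n)) (j : Fin n) : cnt (u ++ [j]) = cnt u + e j := by
  rw [cnt_append, cnt_cons, cnt_nil, add_zero]

theorem e_self (j : Fin n) : e j j = 1 := by simp [e]

theorem e_ne {i j : Fin n} (h : i ≠ j) : e j i = 0 := by simp [e, h]

/-- The lattice points on the path with steps `w`. -/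
def OnPath (w : List (Fin n)) : Set (Fin n → ℕ) := {I | ∃ u v, w = u ++ v ∧ cnt u = I}

theorem onPath_append (u v : List (Fin n)) : cnt u ∈ OnPath (u ++ v) := ⟨u, v, rfl, rfl⟩

theorem OnPath.le {w : List (Fin n)} {I : Fin n → ℕ} (h : I ∈ OnPath w) : I ≤ cnt w := by
  obtain ⟨u, v, rfl, rfl⟩ := h
  rw [cnt_append]; exact le_self_add

theorem mem_onPath_append {u v : List (Fin n)} {I : Fin n → ℕ} :
    I ∈ OnPath (u ++ v) ↔ I ∈ OnPath u ∨ ∃ J ∈ OnPath v, I = cnt u + J := by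
  constructor
  · rintro ⟨s, t, h, rfl⟩
    rcases List.append_eq_append_iff.1 h with ⟨x, rfl, rfl⟩ | ⟨x, rfl, rfl⟩
    · exact Or.inr ⟨cnt x, onPath_append _ _, cnt_append _ _⟩
    · exact Or.inl (onPath_append _ _)
  · rintro (⟨s, t, rfl, rfl⟩ | ⟨J, ⟨s, t, rfl, rfl⟩, rfl⟩)
    · rw [List.append_assoc]; exact onPath_append _ _
    · rw [← List.append_assoc, ← cnt_append]; exact onPath_append _ _

theorem mem_onPath_cons {j : Fin n} {v : List (Fin n)} {I : Fin n → ℕ} :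
    I ∈ OnPath (j :: v) ↔ I = 0 ∨ ∃ J ∈ OnPath v, I = e j + J := by
  constructor
  · rintro ⟨s, t, h, rfl⟩
    rcases s with _ | ⟨x, s⟩
    · exact Or.inl cnt_nil
    · obtain ⟨rfl, rfl⟩ := List.cons_eq_cons.1 h
      exact Or.inr ⟨cnt s, onPath_append _ _, cnt_cons _ _⟩
  · rintro (rfl | ⟨J, ⟨s, t, rfl, rfl⟩, rfl⟩)
    · exact ⟨[], j :: v, rfl, cnt_nil⟩
    · exact ⟨j :: s, t, rfl, cnt_cons _ _⟩

theorem onPath_cons_cons_append {u v : List (Fin n)} {j k : Fin n} {I : Fin n → ℕ} :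
    I ∈ OnPath (u ++ j :: k :: v) ↔ I ∈ OnPath u ∨ I = cnt u + e j ∨
      ∃ J ∈ OnPath v, I = cnt u + e j + e k + J := by
  rw [mem_onPath_append]
  simp only [mem_onPath_cons]
  constructor
  · rintro (h | ⟨J, rfl | ⟨J, rfl | ⟨J, h, rfl⟩, rfl⟩, rfl⟩)
    · exact Or.inl h
    · exact Or.inl ⟨u, [], by simp, by simp⟩
    · exact Or.inr (Or.inl (by rw [add_zero]))
    · exact Or.inr (Or.inr ⟨J, h, by simp only [add_assoc]⟩)
  · rintro (h | rfl | ⟨J, h, rfl⟩)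
    · exact Or.inl h
    · exact Or.inr ⟨_, Or.inr ⟨0, Or.inl rfl, rfl⟩, by rw [add_zero]⟩
    · exact Or.inr ⟨_, Or.inr ⟨_, Or.inr ⟨J, h, rfl⟩, rfl⟩, by simp only [add_assoc]⟩

/-- A swap changes a single point of the path. -/
theorem onPath_swap {u v : List (Fin n)} {j k : Fin n} {I : Fin n → ℕ}
    (h : I ∈ OnPath (u ++ k :: j :: v)) :
    I = cnt u + e k ∨ I ∈ OnPath (u ++ j :: k :: v) := by
  rw [onPath_cons_cons_append] at h ⊢
  rcases h with h | h | ⟨J, h, rfl⟩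
  · exact Or.inr (Or.inl h)
  · exact Or.inl h
  · exact Or.inr (Or.inr (Or.inr ⟨J, h, by rw [add_right_comm (cnt u)]⟩))

theorem cnt_swap (u v : List (Fin n)) (j k : Fin n) :
    cnt (u ++ k :: j :: v) = cnt (u ++ j :: k :: v) := by
  simp only [cnt_append, cnt_cons]
  rw [add_left_comm (e k)]

/-- Two points of a path are comparable. -/
theorem onPath_le_or_le {w : List (Fin n)} {I J : Fin n → ℕ} (hI : I ∈ OnPath w)
    (hJ : J ∈ OnPath w) : I ≤ J ∨ J ≤ I := by
  obtain ⟨s, t, rfl, rfl⟩ := hI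
  obtain ⟨s', t', h, rfl⟩ := hJ
  rcases List.append_eq_append_iff.1 h with ⟨x, rfl, rfl⟩ | ⟨x, rfl, rfl⟩
  · left; rw [cnt_append]; exact le_self_add
  · right; rw [cnt_append]; exact le_self_add

theorem cnt_eq_iff_perm {w w' : List (Fin n)} : cnt w = cnt w' ↔ w.Perm w' := by
  rw [List.perm_iff_count]
  exact ⟨fun h i => congrFun h i, fun h => funext h⟩

theorem exists_cnt_eq (I : Fin n → ℕ) : ∃ w : List (Fin n), cnt w = I := by
  refine ⟨(∑ i, I i • ({i} : Multiset (Fin n))).toList, ?_⟩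
  funext i
  rw [cnt, ← Multiset.coe_count, Multiset.coe_toList, Multiset.count_sum']
  simp [Multiset.count_nsmul, Multiset.count_singleton]

/-- The sorted word, with steps in increasing order. -/
theorem exists_sorted_cnt_eq (I : Fin n → ℕ) :
    ∃ w : List (Fin n), w.Pairwise (· ≤ ·) ∧ cnt w = I := by
  obtain ⟨w, rfl⟩ := exists_cnt_eq I
  refine ⟨w.mergeSort, List.pairwise_mergeSort' _ _, cnt_eq_iff_perm.2 (List.mergeSort_perm _ _)⟩

/-- The reversely sorted word, with steps in decreasing order. -/
theorem exists_antisorted_cnt_eq (I : Fin n → ℕ) :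
    ∃ w : List (Fin n), w.Pairwise (· ≥ ·) ∧ cnt w = I := by
  obtain ⟨w, h, rfl⟩ := exists_sorted_cnt_eq I
  exact ⟨w.reverse, List.pairwise_reverse.2 h, cnt_eq_iff_perm.2 w.reverse_perm⟩

/-- A swap of an ascent. -/
def Step (w w' : List (Fin n)) : Prop :=
  ∃ u v j k, j < k ∧ w = u ++ j :: k :: v ∧ w' = u ++ k :: j :: v

theorem Step.cnt_eq {w w' : List (Fin n)} (h : Step w w') : cnt w' = cnt w := by
  obtain ⟨u, v, j, k, -, rfl, rfl⟩ := h
  exact cnt_swap _ _ _ _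

/-- The number of pairs of steps in increasing order. -/
def ascents : List (Fin n) → ℕ
  | [] => 0
  | x :: l => l.countP (x < ·) + ascents l

theorem Step.ascents_lt {w w' : List (Fin n)} (h : Step w w') : ascents w' < ascents w := by
  obtain ⟨u, v, j, k, hjk, rfl, rfl⟩ := h
  induction u with
  | nil => simp [ascents, hjk, hjk.not_gt]; omega
  | cons x u ih =>
    have : (u ++ k :: j :: v).countP (x < ·) = (u ++ j :: k :: v).countP (x < ·) :=
      List.Perm.countP_eq _ (List.Perm.append_left u (List.Perm.swap j k v))
    simp only [List.cons_append, ascents, this]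
    omega

theorem exists_ascent {w : List (Fin n)} (h : ¬ w.Pairwise (· ≥ ·)) :
    ∃ u v j k, j < k ∧ w = u ++ j :: k :: v := by
  rw [← List.isChain_iff_pairwise] at h
  induction w with
  | nil => simp at h
  | cons x l ih =>
    rcases l with _ | ⟨y, l⟩
    · simp at h
    · rw [List.isChain_cons_cons, not_and_or] at h
      rcases h with h | h
      · exact ⟨[], l, x, y, not_le.1 h, rfl⟩
      · obtain ⟨u, v, j, k, hjk, h⟩ := ih h
        exact ⟨x :: u, v, j, k, hjk, by rw [h]; rfl⟩

/-- Bubble sort: while an ascent remains, swap it, which lowers `ascents`. -/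
theorem reflTransGen_step_antisorted {w w₁ : List (Fin n)} (h₁ : w₁.Pairwise (· ≥ ·))
    (h : cnt w = cnt w₁) : Relation.ReflTransGen Step w w₁ := by
  by_cases hw : w.Pairwise (· ≥ ·)
  · rw [(cnt_eq_iff_perm.1 h).eq_of_pairwise' hw h₁]
  · obtain ⟨u, v, j, k, hjk, rfl⟩ := exists_ascent hw
    have hs : Step (u ++ j :: k :: v) (u ++ k :: j :: v) := ⟨u, v, j, k, hjk, rfl, rfl⟩
    have := hs.ascents_lt
    exact .head hs (reflTransGen_step_antisorted h₁ (hs.cnt_eq.trans h))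
termination_by ascents w

/-- There is a chain of `m` swaps from the sorted word `w₀` to `w` along which all points of the
paths satisfy `D`. -/
def Good (D : Set (Fin n → ℕ)) (w₀ : List (Fin n)) : ℕ → List (Fin n) → Prop
  | 0, w => w = w₀ ∧ OnPath w ⊆ D
  | m + 1, w => OnPath w ⊆ D ∧ ∃ w', Step w' w ∧ Good D w₀ m w'

theorem Good.onPath_subset {D : Set (Fin n → ℕ)} {w₀ w : List (Fin n)} {m : ℕ}
    (h : Good D w₀ m w) : OnPath w ⊆ D := by
  cases m with
  | zero => exact h.2
  | succ m => exact h.1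

/-- A set of points that is closed under the exchange of the two middle points of a cube. -/
def CubeClosed (a : Fin n → ℕ) (D : Set (Fin n → ℕ)) : Prop :=
  ∀ (I : Fin n → ℕ) (j k l : Fin n), j < k → k < l → I + e j + e k + e l ≤ a →
    I ∈ D → I + e j ∈ D → I + e l ∈ D → I + e j + e k ∈ D → I + e k + e l ∈ D →
    I + e j + e k + e l ∈ D → (I + e k ∈ D ↔ I + e j + e l ∈ D)

/-- The word `x` is the offset between the two swap positions: offset `0` means the same swap, `1`
overlapping swaps (a braid), and at least `2` disjoint swaps, which can be undone together. -/
theorem step_diamond_aux {u v u' v' : List (Fin n)} {j k j' k' : Fin n} (hjk : j < k)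
    (hjk' : j' < k') (x : List (Fin n)) (hu : u' = u ++ x)
    (hx : k :: j :: v = x ++ k' :: j' :: v') :
    u ++ j :: k :: v = u' ++ j' :: k' :: v' ∨
    (∃ w₀, Step w₀ (u ++ j :: k :: v) ∧ Step w₀ (u' ++ j' :: k' :: v') ∧
      OnPath (u ++ j :: k :: v) ⊆ OnPath w₀ ∪ OnPath (u ++ k :: j :: v) ∧
      OnPath (u' ++ j' :: k' :: v') ⊆ OnPath w₀ ∪ OnPath (u ++ k :: j :: v)) ∨
    ∃ i, j' < i ∧ i < k ∧ j = i ∧ k' = i ∧ u' = u ++ [k] ∧ v = j' :: v' := by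
  subst hu
  rcases x with _ | ⟨x, _ | ⟨y, s⟩⟩
  · obtain ⟨rfl, rfl, rfl⟩ : k = k' ∧ j = j' ∧ v = v' := by simpa using hx
    left; simp
  · obtain ⟨rfl, rfl, rfl⟩ : k = x ∧ j = k' ∧ v = j' :: v' := by simpa using hx
    exact Or.inr (Or.inr ⟨j, hjk', hjk, rfl, rfl, rfl, rfl⟩)
  · obtain ⟨rfl, rfl, rfl⟩ : k = x ∧ j = y ∧ v = s ++ k' :: j' :: v' := by simpa using hx
    refine Or.inr (Or.inl ⟨u ++ j :: k :: (s ++ j' :: k' :: v'),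
      ⟨u ++ j :: k :: s, v', j', k', hjk', by simp, by simp⟩,
      ⟨u, s ++ j' :: k' :: v', j, k, hjk, by simp, by simp⟩, ?_, ?_⟩)
    · intro I hI
      rw [show u ++ j :: k :: (s ++ k' :: j' :: v') = (u ++ j :: k :: s) ++ k' :: j' :: v' by
        simp] at hI
      rcases onPath_swap hI with rfl | h
      · right
        rw [show u ++ k :: j :: (s ++ k' :: j' :: v') =
          (u ++ k :: j :: s) ++ k' :: j' :: v' by simp, onPath_cons_cons_append]
        exact Or.inr (Or.inl (by rw [cnt_swap u s k j]))
      · left; simpa using h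
    · intro I hI
      rw [show u ++ k :: j :: s ++ j' :: k' :: v' = u ++ k :: j :: (s ++ j' :: k' :: v') by
        simp] at hI
      rcases onPath_swap hI with rfl | h
      · right
        rw [onPath_cons_cons_append]
        exact Or.inr (Or.inl rfl)
      · exact Or.inl h

/-- Two distinct swaps that lead to the same word either commute or form a braid. -/
theorem step_diamond {w w₁ w₂ : List (Fin n)} (h₁ : Step w₁ w) (h₂ : Step w₂ w) :
    w₁ = w₂ ∨ (∃ v, Step v w₁ ∧ Step v w₂ ∧ OnPath w₁ ⊆ OnPath v ∪ OnPath w ∧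
      OnPath w₂ ⊆ OnPath v ∪ OnPath w) ∨
    ∃ u v j k l, j < k ∧ k < l ∧ w = u ++ l :: k :: j :: v ∧
      ((w₁ = u ++ k :: l :: j :: v ∧ w₂ = u ++ l :: j :: k :: v) ∨
        (w₁ = u ++ l :: j :: k :: v ∧ w₂ = u ++ k :: l :: j :: v)) := by
  obtain ⟨u, v, j, k, hjk, rfl, hw⟩ := h₁
  obtain ⟨u', v', j', k', hjk', rfl, hw'⟩ := h₂
  have hww := hw.symm.trans hw'
  rcases List.append_eq_append_iff.1 hww with ⟨x, hu, hx⟩ | ⟨x, hu, hx⟩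
  · rcases step_diamond_aux hjk hjk' x hu hx with h | ⟨w₀, h₁, h₂, h₃, h₄⟩ | ⟨i, hi, hi', h⟩
    · exact Or.inl h
    · exact Or.inr (Or.inl ⟨w₀, h₁, h₂, hw ▸ h₃, hw ▸ h₄⟩)
    · obtain ⟨rfl, rfl, rfl, rfl⟩ := h
      exact Or.inr (Or.inr ⟨u, v', j', k', k, hi, hi', hw, Or.inl ⟨rfl, by simp⟩⟩)
  · rcases step_diamond_aux hjk' hjk x hu hx with h | ⟨w₀, h₁, h₂, h₃, h₄⟩ | ⟨i, hi, hi', h⟩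
    · exact Or.inl h.symm
    · exact Or.inr (Or.inl ⟨w₀, h₂, h₁, hw' ▸ h₄, hw' ▸ h₃⟩)
    · obtain ⟨rfl, rfl, rfl, rfl⟩ := h
      exact Or.inr (Or.inr ⟨u', v, j, k, k', hi, hi', hw', Or.inr ⟨by simp, rfl⟩⟩)

/-- Goodness passes to all words below, in the weak order. -/
theorem Good.of_step {a : Fin n → ℕ} {D : Set (Fin n → ℕ)} (hD : CubeClosed a D)
    {w₀ : List (Fin n)} (h₀ : w₀.Pairwise (· ≤ ·)) (m : ℕ) :
    ∀ {w w' : List (Fin n)}, cnt w = a → Good D w₀ m w → Step w' w →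
      ∃ m', m = m' + 1 ∧ Good D w₀ m' w' := by
  induction m using Nat.strong_induction_on with
  | _ m ih =>
  intro w w' hwa hw hs
  rcases m with _ | m
  · obtain ⟨rfl, -⟩ := hw
    obtain ⟨u, v, j, k, hjk, -, rfl⟩ := hs
    have := (List.pairwise_append.1 h₀).2.1
    exact absurd (List.rel_of_pairwise_cons this (by simp)) hjk.not_ge
  refine ⟨m, rfl, ?_⟩
  obtain ⟨hwD, w₁, hs₁, hg₁⟩ := hw
  have h₁a : cnt w₁ = a := hs₁.cnt_eq.symm.trans hwa
  have h₁D := hg₁.onPath_subset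
  rcases step_diamond hs₁ hs with rfl | ⟨x, hx₁, hx, -, hxD⟩ | ⟨u, v, j, k, l, hjk, hkl, rfl, h⟩
  · exact hg₁
  · obtain ⟨m', rfl, hg⟩ := ih m (Nat.lt_succ_self m) h₁a hg₁ hx₁
    exact ⟨fun I hI => (hxD hI).elim (fun h => hg.onPath_subset h) fun h => hwD h, x, hx, hg⟩
  -- Braid case: two uses of the induction hypothesis descend along the known side of the hexagon to
  -- `u ++ j :: k :: l :: v`. These paths cover all cube vertices except one middle point, which
  -- `CubeClosed` supplies; the chain is then rebuilt along the other side.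
  · have hle : cnt u + e j + e k + e l ≤ a := by
      rw [← hwa, cnt_append, cnt_cons, cnt_cons, cnt_cons]
      intro i; simp only [Pi.add_apply]; omega
    have hcube := hD (cnt u) j k l hjk hkl hle
    have m0 : ∀ (v : List (Fin n)), cnt u ∈ OnPath (u ++ v) := fun v => onPath_append u v
    have m1 : ∀ (x : Fin n) (v : List (Fin n)), cnt u + e x ∈ OnPath (u ++ x :: v) :=
      fun x v => ⟨u ++ [x], v, by simp, cnt_concat _ _⟩
    have m2 : ∀ (x y : Fin n) (v : List (Fin n)), cnt u + e x + e y ∈ OnPath (u ++ x :: y :: v) :=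
      fun x y v => ⟨u ++ [x, y], v, by simp, by
        rw [cnt_append, cnt_cons, cnt_cons, cnt_nil, add_zero, add_assoc]⟩
    have m3 : ∀ (x y z : Fin n) (v : List (Fin n)),
        cnt u + e x + e y + e z ∈ OnPath (u ++ x :: y :: z :: v) :=
      fun x y z v => ⟨u ++ [x, y, z], v, by simp, by
        rw [cnt_append, cnt_cons, cnt_cons, cnt_cons, cnt_nil, add_zero]; simp only [add_assoc]⟩
    have swap2 : ∀ x y z : Fin n,
        u ++ x :: y :: z :: v = (u ++ [x]) ++ y :: z :: v := by simp
    have st1 : ∀ (x y z : Fin n), x < y → Step (u ++ x :: y :: z :: v) (u ++ y :: x :: z :: v) :=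
      fun x y z h => ⟨u, z :: v, x, y, h, rfl, rfl⟩
    have st2 : ∀ (x y z : Fin n), y < z → Step (u ++ x :: y :: z :: v) (u ++ x :: z :: y :: v) :=
      fun x y z h => ⟨u ++ [x], v, y, z, h, by simp, by simp⟩
    rcases h with ⟨rfl, rfl⟩ | ⟨rfl, rfl⟩
    · obtain ⟨m', rfl, hg⟩ := ih m (Nat.lt_succ_self m) h₁a hg₁ (st2 k j l (hjk.trans hkl))
      have h₂a := (st2 k j l (hjk.trans hkl)).cnt_eq.symm.trans h₁a
      obtain ⟨m', rfl, hg'⟩ := ih m' (by omega) h₂a hg (st1 j k l hjk)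
      have hgD := hg'.onPath_subset
      have key : cnt u + e j + e l ∈ D :=
        (hcube (hwD (m0 _)) (hgD (m1 _ _)) (hwD (m1 _ _)) (hgD (m2 _ _ _))
          (by rw [add_right_comm]; exact hwD (m2 _ _ _)) (hgD (m3 _ _ _ _))).1 (h₁D (m1 _ _))
      have hD2 : OnPath (u ++ j :: l :: k :: v) ⊆ D := by
        intro I hI
        rw [swap2] at hI
        rcases onPath_swap hI with rfl | h
        · rwa [cnt_concat]
        · exact hgD (by simpa using h)
      refine ⟨fun I hI => ?_, _, st1 j l k (hjk.trans hkl), hD2, _, st2 j k l hkl, hg'⟩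
      rcases onPath_swap hI with rfl | h
      · exact hwD (m1 _ _)
      · exact hD2 h
    · obtain ⟨m', rfl, hg⟩ := ih m (Nat.lt_succ_self m) h₁a hg₁ (st1 j l k (hjk.trans hkl))
      have h₂a := (st1 j l k (hjk.trans hkl)).cnt_eq.symm.trans h₁a
      obtain ⟨m', rfl, hg'⟩ := ih m' (by omega) h₂a hg (st2 j k l hkl)
      have hgD := hg'.onPath_subset
      have key : cnt u + e k ∈ D :=
        (hcube (hwD (m0 _)) (hgD (m1 _ _)) (hwD (m1 _ _)) (hgD (m2 _ _ _))
          (by rw [add_right_comm]; exact hwD (m2 _ _ _)) (hgD (m3 _ _ _ _))).2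
          (by rw [add_right_comm]; exact h₁D (m2 _ _ _))
      have hD2 : OnPath (u ++ k :: j :: l :: v) ⊆ D := by
        intro I hI
        rcases onPath_swap hI with rfl | h
        · exact key
        · exact hgD h
      refine ⟨fun I hI => ?_, _, st2 k j l (hjk.trans hkl), hD2, _, st1 j k l hjk, hg'⟩
      rw [swap2] at hI
      rcases onPath_swap hI with rfl | h
      · rw [cnt_concat, add_right_comm]; exact hwD (m2 _ _ _)
      · exact hD2 (by simpa using h)

/-- If all paths of some chain of swaps from the sorted to the reversely sorted word lie in `D`,
then `D` contains all points below `a`. -/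
theorem Good.mem_of_le {a : Fin n → ℕ} {D : Set (Fin n → ℕ)} (hD : CubeClosed a D)
    {w₀ w₁ : List (Fin n)} (h₀ : w₀.Pairwise (· ≤ ·)) (h₁ : w₁.Pairwise (· ≥ ·))
    (h₁a : cnt w₁ = a) {m : ℕ} (h : Good D w₀ m w₁) {I : Fin n → ℕ} (hI : I ≤ a) : I ∈ D := by
  obtain ⟨u, rfl⟩ := exists_cnt_eq I
  obtain ⟨v, hv⟩ := exists_cnt_eq (a - cnt u)
  have hw : cnt (u ++ v) = a := by rw [cnt_append, hv, add_tsub_cancel_of_le hI]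
  have hchain := reflTransGen_step_antisorted h₁ (hw.trans h₁a.symm)
  have key : ∃ m, Good D w₀ m (u ++ v) := by
    have : ∀ w, Relation.ReflTransGen Step w w₁ → cnt w = a ∧ ∃ m, Good D w₀ m w := by
      intro w hw
      induction hw using Relation.ReflTransGen.head_induction_on with
      | refl => exact ⟨h₁a, m, h⟩
      | head hs _ ih =>
        obtain ⟨ha, m, hg⟩ := ih
        obtain ⟨m', -, hg'⟩ := Good.of_step hD h₀ m ha hg hs
        exact ⟨hs.cnt_eq.symm.trans ha, m', hg'⟩
    exact (this _ hchain).2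
  obtain ⟨m, hm⟩ := key
  exact hm.onPath_subset (onPath_append u v)

/-- A sequence of swaps starting from the word `w₀`, and the set of all points of its paths.
Only the swaps allowed by `F` are used. -/
inductive Sweep (F : (Fin n → ℕ) → Fin n → Fin n → Prop) (w₀ : List (Fin n)) :
    Set (Fin n → ℕ) → List (Fin n) → Prop
  | base : Sweep F w₀ (OnPath w₀) w₀
  | step {A : Set (Fin n → ℕ)} {u v : List (Fin n)} {j k : Fin n} (hjk : j < k)
      (hF : F (cnt u) j k) (h : Sweep F w₀ A (u ++ j :: k :: v)) :
      Sweep F w₀ (insert (cnt u + e k) A) (u ++ k :: j :: v)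

variable {F : (Fin n → ℕ) → Fin n → Fin n → Prop} {w₀ w : List (Fin n)} {A : Set (Fin n → ℕ)}

theorem Sweep.cnt_eq (h : Sweep F w₀ A w) : cnt w = cnt w₀ := by
  induction h with
  | base => rfl
  | step _ _ _ ih => rw [cnt_swap, ih]

theorem Sweep.onPath_subset (h : Sweep F w₀ A w) : OnPath w ⊆ A := by
  induction h with
  | base => exact subset_rfl
  | step _ _ _ ih =>
    intro I hI
    rcases onPath_swap hI with rfl | h
    · exact Set.mem_insert _ _
    · exact Set.mem_insert_of_mem _ (ih h)

theorem Sweep.exists_good (h : Sweep F w₀ A w) {D : Set (Fin n → ℕ)} (hD : A ⊆ D) :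
    ∃ m, Good D w₀ m w := by
  induction h with
  | base => exact ⟨0, rfl, hD⟩
  | step hjk hF h ih =>
    obtain ⟨m, hm⟩ := ih ((Set.subset_insert _ _).trans hD)
    exact ⟨m + 1, (Sweep.step hjk hF h).onPath_subset.trans hD, _, ⟨_, _, _, _, hjk, rfl, rfl⟩, hm⟩

/-- The current path of a sweep has all visited points on one side. -/
theorem Sweep.le_of_lt (h : Sweep F w₀ A w) :
    ∀ I ∈ A, ∀ J ∈ OnPath w, ∀ j k : Fin n, j < k → J k < I k → J j ≤ I j := by
  induction h with
  | base =>
    intro I hI J hJ j k _ h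
    rcases onPath_le_or_le hI hJ with h' | h'
    · exact absurd (h' k) h.not_ge
    · exact h' j
  | @step A u v j k hjk hF h ih =>
    intro I hI J hJ j' k' hjk' hlt
    rcases hI with rfl | hI
    · have hk : cnt u + e k ∈ OnPath (u ++ k :: j :: v) :=
        ⟨u ++ [k], j :: v, by simp, cnt_concat _ _⟩
      rcases onPath_le_or_le hk hJ with h' | h'
      · exact absurd (h' k') hlt.not_ge
      · exact h' j'
    · rcases onPath_swap hJ with rfl | hJ
      -- For the new path point, compare with an old one having the same `j'`-coordinate and no
      -- larger a `k'`-coordinate: the far corner of the parallelogram if `j' = k`, its base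
      -- otherwise.
      · rcases eq_or_ne j' k with rfl | hne
        · have h1 : cnt u + e j + e j' ∈ OnPath (u ++ j :: j' :: v) :=
            ⟨u ++ [j, j'], v, by simp, by
              rw [cnt_append, cnt_cons, cnt_cons, cnt_nil, add_zero, add_assoc]⟩
          have := ih I hI _ h1 j' k' hjk' (by
            simpa [e_ne hjk'.ne', e_ne (hjk.trans hjk').ne'] using hlt)
          simp only [Pi.add_apply, e_self, e_ne hjk.ne'] at this ⊢
          omega
        · have := ih I hI _ (onPath_append u _) j' k' hjk' (by
            simp only [Pi.add_apply] at hlt; omega)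
          simpa [e_ne hne] using this
      · exact ih I hI J hJ j' k' hjk' hlt

end Words

/-! ### Interpolating unit values on a sweep by a pure spinor. -/

section Existence

variable {n : ℕ}

/-- The lattice point `I` as a set of pairs: those `(i, r)` with `r < I i`. -/
def boxSet (m : ℕ) (I : Fin n → ℕ) : Finset (Fin n ×ₗ Fin m) :=
  Finset.univ.filter fun x => ((ofLex x).2 : ℕ) < I (ofLex x).1

theorem mem_boxSet {m : ℕ} {I : Fin n → ℕ} {j : Fin n} {r : Fin m} :
    toLex (j, r) ∈ boxSet m I ↔ (r : ℕ) < I j := by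
  simp [boxSet]

theorem boxSet_add_e {m : ℕ} (I : Fin n → ℕ) (j : Fin n) (h : I j < m) :
    boxSet m (I + e j) = insert (toLex (j, ⟨I j, h⟩)) (boxSet m I) := by
  ext x
  obtain ⟨⟨i, r⟩, rfl⟩ := toLex.surjective x
  rw [Finset.mem_insert, mem_boxSet, mem_boxSet, toLex.injective.eq_iff, Prod.mk.injEq]
  rcases eq_or_ne i j with rfl | hij
  · simp only [Pi.add_apply, e_self, true_and, Fin.ext_iff]; omega
  · simp only [Pi.add_apply, e_ne hij, add_zero, hij, false_and, false_or]

theorem notMem_boxSet {m : ℕ} (I : Fin n → ℕ) (j : Fin n) (h : I j < m) :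
    toLex (j, ⟨I j, h⟩) ∉ boxSet m I := by
  simp [mem_boxSet]

theorem boxSet_zero (m : ℕ) : boxSet m (0 : Fin n → ℕ) = ∅ := by
  simp [boxSet]

variable {R : Type*} [CommRing R]

/-- Any unit values along a path are the values of a monomial. -/
theorem exists_prod_eq (m : ℕ) (u : (Fin n → ℕ) → R) (w : List (Fin n)) (hm : ∀ i, cnt w i ≤ m)
    (hu : ∀ I ∈ OnPath w, IsUnit (u I)) :
    ∃ ρ : Fin n ×ₗ Fin m → R, ∀ I ∈ OnPath w, u 0 * ∏ s ∈ boxSet m I, ρ s = u I := by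
  induction w using List.reverseRecOn with
  | nil =>
    refine ⟨1, fun I hI => ?_⟩
    obtain ⟨s, t, h, rfl⟩ := hI
    obtain ⟨rfl, -⟩ := List.append_eq_nil_iff.1 h.symm
    simp [cnt_nil, boxSet_zero]
  | append_singleton s j ih =>
    have hsub : OnPath s ⊆ OnPath (s ++ [j]) := fun I hI => mem_onPath_append.2 (Or.inl hI)
    have hlt : cnt s j < m := by
      have := hm j
      rw [cnt_concat, Pi.add_apply, e_self] at this
      omega
    obtain ⟨ρ, hρ⟩ := ih (fun i => le_trans (by rw [cnt_concat]; simp) (hm i))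
      fun I hI => hu I (hsub hI)
    have hs : cnt s ∈ OnPath s := ⟨s, [], by simp, rfl⟩
    obtain ⟨b, hb⟩ := (hu _ (hsub hs)).exists_right_inv
    -- The last step adds an element found in no earlier point, so its weight can be set freely to
    -- the ratio of the last two values.
    have hnot : ∀ I ∈ OnPath s, toLex (j, ⟨cnt s j, hlt⟩) ∉ boxSet m I := fun I hI => by
      rw [mem_boxSet, not_lt]; exact OnPath.le hI j
    have hold : ∀ I ∈ OnPath s, u 0 * ∏ x ∈ boxSet m I,
        Function.update ρ (toLex (j, ⟨cnt s j, hlt⟩)) (b * u (cnt s + e j)) x = u I := by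
      intro I hI
      rw [Finset.prod_update_of_notMem (hnot I hI), hρ I hI]
    refine ⟨Function.update ρ (toLex (j, ⟨cnt s j, hlt⟩)) (b * u (cnt s + e j)), fun I hI => ?_⟩
    rw [mem_onPath_append] at hI
    rcases hI with hI | ⟨J, hJ, rfl⟩
    · exact hold I hI
    · rw [mem_onPath_cons] at hJ
      rcases hJ with rfl | ⟨J, ⟨x, y, h, rfl⟩, rfl⟩
      · simpa using hold _ hs
      · obtain ⟨rfl, -⟩ := List.append_eq_nil_iff.1 h.symm
        rw [cnt_nil, add_zero, boxSet_add_e _ _ hlt, Finset.prod_insert (hnot _ hs),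
          Function.update_self, mul_left_comm, hold _ hs]
        linear_combination u (cnt s + e j) * hb

/-- Any unit values at the points of a sweep are the values of a pure spinor. -/
theorem Sweep.exists_isPure {F : (Fin n → ℕ) → Fin n → Fin n → Prop} {w₀ w : List (Fin n)}
    {A : Set (Fin n → ℕ)} (h : Sweep F w₀ A w) (m : ℕ) (u : (Fin n → ℕ) → R)
    (hm : ∀ i, cnt w₀ i ≤ m) (hu : ∀ I ∈ A, IsUnit (u I)) :
    ∃ X : Finset (Fin n ×ₗ Fin m) → R, IsPure X ∧ ∀ I ∈ A, X (boxSet m I) = u I := by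
  induction h with
  | base =>
    obtain ⟨ρ, hρ⟩ := exists_prod_eq m u w₀ hm hu
    exact ⟨_, isPure_prod (u 0) ρ, hρ⟩
  | @step A s v j k hjk hF h ih =>
    obtain ⟨X, hX, hXA⟩ := ih fun I hI => hu I (Set.mem_insert_of_mem _ hI)
    have hcnt : cnt s + e j + e k + cnt v = cnt w₀ := by
      rw [← h.cnt_eq, cnt_append, cnt_cons, cnt_cons]; simp only [add_assoc]
    have hj : cnt s j < m := by
      have h1 := congrFun hcnt j
      have h2 := hm j
      simp only [Pi.add_apply, e_self] at h1
      omega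
    have hk : cnt s k < m := by
      have h1 := congrFun hcnt k
      have h2 := hm k
      simp only [Pi.add_apply, e_self] at h1
      omega
    set p : Fin n ×ₗ Fin m := toLex (j, ⟨cnt s j, hj⟩) with hp
    set q : Fin n ×ₗ Fin m := toLex (k, ⟨cnt s k, hk⟩) with hq
    have hpq : p ≠ q := fun h => hjk.ne (congrArg (fun x => (ofLex x).1) h)
    have hJ : cnt s + e j ∈ OnPath (s ++ j :: k :: v) := ⟨s ++ [j], k :: v, by simp, cnt_concat _ _⟩
    have hJA := h.onPath_subset hJ
    obtain ⟨b, hb⟩ := (hu _ (Set.mem_insert_of_mem _ hJA)).exists_right_inv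
    set S := boxSet m (cnt s) with hS
    -- At `insert q S` the transvection adds a sign times `t * X (insert p S)`, and `X (insert p S)`
    -- is the unit value at the replaced vertex, with inverse `b`. This coefficient yields the
    -- prescribed value.
    refine ⟨transvect p q (jwSign R q S * jwSign R p S * b * (u (cnt s + e k) - X (insert q S))) X,
      hX.transvect hpq _, fun I hI => ?_⟩
    rcases hI with rfl | hI
    · have h1 : q ∉ S := notMem_boxSet _ _ _
      have h2 : p ∉ S := notMem_boxSet _ _ _
      have h3 : X (insert p S) = u (cnt s + e j) := by
        rw [← hXA _ hJA, boxSet_add_e _ _ hj]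
      have h4 := jwSign_mul_self (R := R) p S
      have h5 := jwSign_mul_self (R := R) q S
      rw [boxSet_add_e _ _ hk]
      simp only [transvect, create, annihilate, ← hS, ← hq, Finset.mem_insert_self, if_true,
        Finset.erase_insert h1, h2, if_false, h3, jwSign_insert h1, lt_irrefl, one_mul]
      linear_combination (u (cnt s + e k) - X (insert q S)) *
        (jwSign R q S * jwSign R q S * (jwSign R p S * jwSign R p S) * hb +
          h4 * (jwSign R q S * jwSign R q S) + h5)
    · rw [← hXA I hI]
      -- The operator sees only sets containing `q` and not `p`; by `Sweep.le_of_lt`, a visited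
      -- point containing `q` already contains `p`.
      have : create q (annihilate p X) (boxSet m I) = 0 := by
        by_cases hqI : q ∈ boxSet m I
        · have h1 : cnt s k < I k := mem_boxSet.1 hqI
          have h2 := h.le_of_lt I hI _ hJ j k hjk (by simpa [e_ne hjk.ne'] using h1)
          have h3 : p ∈ boxSet m I := by
            rw [hp, mem_boxSet]
            simpa [e_self, Nat.succ_le_iff] using h2
          simp [create, annihilate, h3, hpq]
        · simp [create, hqI]
      rw [transvect, this, mul_zero, add_zero]

/-- The sign that turns Pfaffian relations into cube relations. -/
def cubeSign (R : Type*) [CommRing R] (N : ℕ) : R := if N % 4 = 3 then -1 else 1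

theorem cubeSign_mul_self (N : ℕ) : cubeSign R N * cubeSign R N = 1 := by
  rw [cubeSign]; split_ifs <;> simp

/-- Among four consecutive residues modulo `4` exactly one carries a minus sign. This reverses the
sign of the term pairing the bottom and top of a cube, the only discrepancy between the two
recurrences. -/
theorem cubeSign_mul_add_three (N : ℕ) :
    cubeSign R N * cubeSign R (N + 3) = -(cubeSign R (N + 1) * cubeSign R (N + 2)) := by
  have h : N % 4 = 0 ∨ N % 4 = 1 ∨ N % 4 = 2 ∨ N % 4 = 3 := by omega
  rcases h with h | h | h | h <;> simp [cubeSign, Nat.add_mod, h]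

/-- Any unit values at the points of a sweep extend to a solution of the cube recurrence. -/
theorem Sweep.exists_cubeRelations {F : (Fin n → ℕ) → Fin n → Fin n → Prop}
    {w₀ w : List (Fin n)} {A : Set (Fin n → ℕ)} (h : Sweep F w₀ A w) (u : (Fin n → ℕ) → R)
    (hu : ∀ I ∈ A, IsUnit (u I)) :
    ∃ x : (Fin n → ℕ) → R, (∀ I ∈ A, x I = u I) ∧
      ∀ (I : Fin n → ℕ) (j k l : Fin n), j < k → k < l → I + e j + e k + e l ≤ cnt w₀ →
        x (I + e j + e l) * x (I + e k) =
          x I * x (I + e j + e k + e l) + x (I + e j + e k) * x (I + e l)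
            + x (I + e k + e l) * x (I + e j) := by
  have hsq := cubeSign_mul_self (R := R)
  obtain ⟨X, hX, hXA⟩ := h.exists_isPure (∑ i, cnt w₀ i) (fun I => cubeSign R (∑ i, I i) * u I)
    (fun i => Finset.single_le_sum (f := cnt w₀) (fun _ _ => Nat.zero_le _) (Finset.mem_univ i))
    fun I hI => (IsUnit.of_mul_eq_one _ (hsq _)).mul (hu I hI)
  refine ⟨fun I => cubeSign R (∑ i, I i) * X (boxSet _ I), fun I hI => ?_, ?_⟩
  · simp only [hXA I hI]
    linear_combination u I * hsq (∑ i, I i)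
  intro I j k l hjk hkl hle
  have hjl := hjk.trans hkl
  have hb : ∀ i, (I + e j + e k + e l) i ≤ ∑ i, cnt w₀ i := fun i => (hle i).trans
    (Finset.single_le_sum (f := cnt w₀) (fun _ _ => Nat.zero_le _) (Finset.mem_univ i))
  generalize hm : ∑ i, cnt w₀ i = m at *
  have hj : I j < m := by
    have := hb j; simp only [Pi.add_apply, e_self] at this; omega
  have hk : I k < m := by
    have := hb k; simp only [Pi.add_apply, e_self] at this; omega
  have hl : I l < m := by
    have := hb l; simp only [Pi.add_apply, e_self] at this; omega
  have bk : ∀ J : Fin n → ℕ, J k = I k → boxSet m (J + e k) =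
      insert (toLex (k, ⟨I k, hk⟩)) (boxSet m J) := fun J hJ => by
    rw [boxSet_add_e J k (hJ ▸ hk)]; simp only [hJ]
  have bl : ∀ J : Fin n → ℕ, J l = I l → boxSet m (J + e l) =
      insert (toLex (l, ⟨I l, hl⟩)) (boxSet m J) := fun J hJ => by
    rw [boxSet_add_e J l (hJ ▸ hl)]; simp only [hJ]
  have b1 := boxSet_add_e I j hj
  have b2 := bk I rfl
  have b3 := bl I rfl
  have b12 := bk (I + e j) (by simp [e_ne hjk.ne'])
  have b13 := bl (I + e j) (by simp [e_ne hjl.ne'])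
  have b23 := bl (I + e k) (by simp [e_ne hkl.ne'])
  have b123 := bl (I + e j + e k) (by simp [e_ne hjl.ne', e_ne hkl.ne'])
  have hsum : ∀ (J : Fin n → ℕ) (i : Fin n), ∑ x, (J + e i) x = ∑ x, J x + 1 := fun J i => by
    simp [Finset.sum_add_distrib, e]
  have key := hX.four_term (p := toLex (j, ⟨I j, hj⟩)) (q := toLex (k, ⟨I k, hk⟩))
    (r := toLex (l, ⟨I l, hl⟩)) (Prod.Lex.toLex_lt_toLex.2 (Or.inl hjk))
    (Prod.Lex.toLex_lt_toLex.2 (Or.inl hkl)) (S := boxSet m I) (notMem_boxSet _ _ _)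
    (notMem_boxSet _ _ _) (notMem_boxSet _ _ _)
  have hs := cubeSign_mul_add_three (R := R) (∑ i, I i)
  simp only [hsum, b123, b12, b13, b23, b1, b2, b3]
  simp only [add_assoc, Nat.reduceAdd]
  linear_combination cubeSign R (∑ i, I i + 1) * cubeSign R (∑ i, I i + 2) * key -
    X (boxSet m I) * X (insert (toLex (l, ⟨I l, hl⟩)) (insert (toLex (k, ⟨I k, hk⟩))
      (insert (toLex (j, ⟨I j, hj⟩)) (boxSet m I)))) * hs

end Existence

/-! ### Positivity and the propagation of agreement. -/

section Uniqueness

/-- A quotient of polynomials that are positive at the point `(1, …, 1)`. -/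
def IsPositive {σ : Type*} (z : FractionRing (MvPolynomial σ ℚ)) : Prop :=
  ∃ f g : MvPolynomial σ ℚ, 0 < MvPolynomial.eval 1 f ∧ 0 < MvPolynomial.eval 1 g ∧
    z = algebraMap _ (FractionRing (MvPolynomial σ ℚ)) f /
      algebraMap _ (FractionRing (MvPolynomial σ ℚ)) g

variable {σ : Type*} {y z : FractionRing (MvPolynomial σ ℚ)}

theorem algebraMap_ne_zero_of_eval_pos {f : MvPolynomial σ ℚ} (h : 0 < MvPolynomial.eval 1 f) :
    algebraMap _ (FractionRing (MvPolynomial σ ℚ)) f ≠ 0 := by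
  intro h0
  rw [map_eq_zero_iff _ (IsFractionRing.injective _ _)] at h0
  simp [h0] at h

theorem IsPositive.ne_zero (hz : IsPositive z) : z ≠ 0 := by
  obtain ⟨f, g, hf, hg, rfl⟩ := hz
  exact div_ne_zero (algebraMap_ne_zero_of_eval_pos hf) (algebraMap_ne_zero_of_eval_pos hg)

theorem IsPositive.mul (hy : IsPositive y) (hz : IsPositive z) : IsPositive (y * z) := by
  obtain ⟨f, g, hf, hg, rfl⟩ := hy
  obtain ⟨f', g', hf', hg', rfl⟩ := hz
  refine ⟨f * f', g * g', by simpa using mul_pos hf hf', by simpa using mul_pos hg hg', ?_⟩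
  rw [map_mul, map_mul, div_mul_div_comm]

theorem IsPositive.div (hy : IsPositive y) (hz : IsPositive z) : IsPositive (y / z) := by
  obtain ⟨f, g, hf, hg, rfl⟩ := hy
  obtain ⟨f', g', hf', hg', rfl⟩ := hz
  refine ⟨f * g', g * f', by simpa using mul_pos hf hg', by simpa using mul_pos hg hf', ?_⟩
  rw [map_mul, map_mul, div_div_div_eq]

theorem IsPositive.add (hy : IsPositive y) (hz : IsPositive z) : IsPositive (y + z) := by
  obtain ⟨f, g, hf, hg, rfl⟩ := hy
  obtain ⟨f', g', hf', hg', rfl⟩ := hz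
  refine ⟨f * g' + g * f', g * g', ?_, by simpa using mul_pos hg hg', ?_⟩
  · simpa using add_pos (mul_pos hf hg') (mul_pos hg hf')
  · rw [div_add_div _ _ (algebraMap_ne_zero_of_eval_pos hg) (algebraMap_ne_zero_of_eval_pos hg')]
    simp only [map_mul, map_add]

theorem isPositive_X (i : σ) :
    IsPositive (algebraMap (MvPolynomial σ ℚ) (FractionRing (MvPolynomial σ ℚ))
      (MvPolynomial.X i)) :=
  ⟨MvPolynomial.X i, 1, by simp, by simp, by simp⟩

/-- The product of the two middle values is a sum of three positive products, hence positive. If one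
factor is positive and shared by both labelings, it can be cancelled, and the other factor is again
positive. -/
theorem cubeClosed_agree {n : ℕ} {a : Fin n → ℕ}
    {x y : (Fin n → ℕ) → FractionRing (MvPolynomial σ ℚ)} (hx : CubeRelations a x)
    (hy : CubeRelations a y) : CubeClosed a {I | y I = x I ∧ IsPositive (x I)} := by
  rintro I j k l hjk hkl hle ⟨e1, p1⟩ ⟨e2, p2⟩ ⟨e3, p3⟩ ⟨e4, p4⟩ ⟨e5, p5⟩ ⟨e6, p6⟩
  have h1 := hx I j k l hjk hkl hle
  have h2 := hy I j k l hjk hkl hle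
  rw [e1, e2, e3, e4, e5, e6, ← h1] at h2
  have hp := ((p1.mul p6).add (p4.mul p3)).add (p5.mul p2)
  rw [← h1] at hp
  constructor
  · rintro ⟨e, p⟩
    rw [Set.mem_ofPred_eq]
    rw [e] at h2
    refine ⟨mul_right_cancel₀ p.ne_zero h2, ?_⟩
    have := hp.div p
    rwa [mul_div_cancel_right₀ _ p.ne_zero] at this
  · rintro ⟨e, p⟩
    rw [Set.mem_ofPred_eq]
    rw [e] at h2
    refine ⟨mul_left_cancel₀ p.ne_zero h2, ?_⟩
    have := hp.div p
    rwa [mul_div_cancel_left₀ _ p.ne_zero] at this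

end Uniqueness

/-! ### Local geometry of a tiling: rhombi found by leftward horizontal motion. -/

section Geometry

variable {n : ℕ} {a : Fin n → ℕ}

/-- The face with lowest vertex `I` and directions `D` belongs to `T`. -/
def Subcomplex.HasFace (T : Subcomplex a) (I : Fin n → ℕ) (D : Finset (Fin n)) : Prop :=
  ∃ F ∈ T.faces, F.base = I ∧ F.dirs = D

theorem Subcomplex.mem_vert_iff {T : Subcomplex a} {I : Fin n → ℕ} :
    I ∈ T.vert ↔ T.HasFace I ∅ := by
  simp only [Subcomplex.vert, Subcomplex.HasFace, Set.mem_ofPred_eq, and_comm]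

instance finite_face (a : Fin n → ℕ) : Finite (Face a) := by
  have hfin : Finite (Set.Iic a × Finset (Fin n)) := inferInstance
  refine Finite.of_injective (fun F : Face a => ((⟨F.base, fun i => le_trans le_self_add (F.le i)⟩,
    F.dirs) : Set.Iic a × Finset (Fin n))) ?_
  rintro ⟨b, D, h⟩ ⟨b', D', h'⟩ heq
  obtain rfl : b = b' := congrArg (fun p => (p.1 : Fin n → ℕ)) heq
  obtain rfl : D = D' := congrArg Prod.snd heq
  rfl

theorem Face.isClosed_carrier (F : Face a) : IsClosed F.carrier := by
  have : F.carrier = Set.Icc (fun i => (F.base i : ℝ))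
      (fun i => (F.base i : ℝ) + (if i ∈ F.dirs then 1 else 0)) := by
    ext x
    simp only [Face.carrier, Set.mem_ofPred_eq, Set.mem_Icc, Pi.le_def, forall_and]
  rw [this]
  exact isClosed_Icc

theorem Face.carrier_subset (F : Face a) : F.carrier ⊆ Set.Icc 0 (fun i => (a i : ℝ)) := by
  intro x hx
  refine ⟨fun i => (Nat.cast_nonneg _).trans (hx i).1, fun i => (hx i).2.trans ?_⟩
  have := F.le i
  show _ ≤ (a i : ℝ)
  split_ifs at this ⊢ <;> exact_mod_cast this

theorem Subcomplex.hasFace_of_le {T : Subcomplex a} {F : Face a} (hF : F ∈ T.faces)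
    {I : Fin n → ℕ} {D : Finset (Fin n)} (h₁ : ∀ i, F.base i ≤ I i)
    (h₂ : ∀ i, I i + (if i ∈ D then 1 else 0) ≤ F.base i + (if i ∈ F.dirs then 1 else 0)) :
    T.HasFace I D := by
  refine ⟨⟨I, D, fun i => (h₂ i).trans (F.le i)⟩, T.down_closed F hF _ fun x hx i => ?_, rfl, rfl⟩
  refine ⟨le_trans (by exact_mod_cast h₁ i) (hx i).1, (hx i).2.trans ?_⟩
  have := h₂ i
  simp only
  split_ifs at this ⊢ <;> exact_mod_cast this

theorem Subcomplex.HasFace.le {T : Subcomplex a} {I : Fin n → ℕ} {D : Finset (Fin n)}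
    (h : T.HasFace I D) (i : Fin n) : I i + (if i ∈ D then 1 else 0) ≤ a i := by
  obtain ⟨F, -, rfl, rfl⟩ := h
  exact F.le i

theorem Subcomplex.HasFace.mono {T : Subcomplex a} {I J : Fin n → ℕ} {D E : Finset (Fin n)}
    (h : T.HasFace J E) (h₁ : ∀ i, J i ≤ I i)
    (h₂ : ∀ i, I i + (if i ∈ D then 1 else 0) ≤ J i + (if i ∈ E then 1 else 0)) :
    T.HasFace I D := by
  obtain ⟨F, hF, rfl, rfl⟩ := h
  exact hasFace_of_le hF h₁ h₂

theorem proj_add (θ : Fin n → ℝ) (x y : Fin n → ℝ) : proj θ (x + y) = proj θ x + proj θ y := by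
  simp [proj, add_mul, Finset.sum_add_distrib]

theorem proj_smul (θ : Fin n → ℝ) (t : ℝ) (x : Fin n → ℝ) : proj θ (t • x) = t • proj θ x := by
  simp [proj, Finset.mul_sum, mul_assoc]

theorem continuous_proj (θ : Fin n → ℝ) : Continuous (proj θ) := by
  unfold proj; fun_prop

/-- A sum of two vectors which projects to a horizontal vector. -/
noncomputable def horizontal (θ : Fin n → ℝ) (j k : Fin n) : Fin n → ℝ :=
  Pi.single k (Real.sin (θ j)) - Pi.single j (Real.sin (θ k))

theorem proj_single (θ : Fin n → ℝ) (j : Fin n) (c : ℝ) :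
    proj θ (Pi.single j c) = (c * Real.cos (θ j), c * Real.sin (θ j)) := by
  simp [proj, Pi.single_apply]

/-- The vertical components cancel. For `j < k`, under `Angles`, the motion is strictly to the left,
from the right vertex of a `{j, k}` rhombus towards its left vertex. -/
theorem proj_horizontal (θ : Fin n → ℝ) (j k : Fin n) :
    proj θ (horizontal θ j k) = (-Real.sin (θ k - θ j), 0) := by
  have h : horizontal θ j k =
      Pi.single k (Real.sin (θ j)) + (-1 : ℝ) • Pi.single j (Real.sin (θ k)) := by
    rw [horizontal, neg_one_smul, sub_eq_add_neg]
  rw [h, proj_add, proj_smul, proj_single, proj_single, Real.sin_sub]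
  ext <;> simp <;> ring

variable {T : Subcomplex a} {θ : Fin n → ℝ}

theorem Subcomplex.support_subset (T : Subcomplex a) :
    T.support ⊆ Set.Icc 0 (fun i => (a i : ℝ)) :=
  Set.iUnion₂_subset fun F _ => F.carrier_subset

theorem Subcomplex.IsTiling.injOn (hT : T.IsTiling θ) : Set.InjOn (proj θ) T.support := by
  obtain ⟨-, φ, hφ⟩ := hT
  intro x hx y hy h
  have : φ ⟨x, hx⟩ = φ ⟨y, hy⟩ := Subtype.ext (by rw [hφ, hφ]; exact h)
  exact congrArg Subtype.val (φ.injective this)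

theorem Subcomplex.IsTiling.exists_proj_eq (hT : T.IsTiling θ) {x : Fin n → ℝ}
    (hx : x ∈ Set.Icc 0 (fun i => (a i : ℝ))) : ∃ y ∈ T.support, proj θ y = proj θ x := by
  obtain ⟨-, φ, hφ⟩ := hT
  refine ⟨φ.symm ⟨proj θ x, x, hx, rfl⟩, (φ.symm _).2, ?_⟩
  rw [← hφ, φ.apply_symm_apply]

/-- Near a point `s` of a tiling, in any direction that does not leave the box, there is a face
through `s`. -/
theorem Subcomplex.IsTiling.exists_face (hT : T.IsTiling θ) {s d : Fin n → ℝ}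
    (hs : s ∈ T.support) {ε : ℝ} (hε : 0 < ε)
    (hd : ∀ t, 0 ≤ t → t ≤ ε → s + t • d ∈ Set.Icc 0 (fun i => (a i : ℝ))) :
    ∃ t : ℝ, 0 < t ∧ ∃ F ∈ T.faces, s ∈ F.carrier ∧ ∃ x ∈ F.carrier,
      proj θ x = proj θ s + t • proj θ d := by
  obtain ⟨-, φ, hφ⟩ := hT
  let p : Set.Icc (0 : ℝ) ε → zonogon a θ := fun t =>
    ⟨proj θ (s + (t : ℝ) • d), _, hd t t.2.1 t.2.2, rfl⟩
  have hp : Continuous p := by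
    refine Continuous.subtype_mk ((continuous_proj θ).comp ?_) _
    fun_prop
  let c : Set.Icc (0 : ℝ) ε → Fin n → ℝ := fun t => (φ.symm (p t) : Fin n → ℝ)
  have hc : Continuous c := continuous_subtype_val.comp (φ.symm.continuous.comp hp)
  have hcp : ∀ t, proj θ (c t) = proj θ (s + (t : ℝ) • d) := fun t => by
    rw [← hφ, φ.apply_symm_apply]
  let t₀ : Set.Icc (0 : ℝ) ε := ⟨0, le_rfl, hε.le⟩
  have hc0 : c t₀ = s := by
    have : p t₀ = φ ⟨s, hs⟩ := Subtype.ext (by rw [hφ]; simp [p, t₀])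
    simp only [c, this, φ.symm_apply_apply]
  -- The faces missing `s` are finite in number, so their union is closed; the lifted segment `c`,
  -- which starts at `s`, avoids it for small `t`, and any face then met by `c` contains `s`.
  let U : Set (Fin n → ℝ) := ⋃ F ∈ {F : Face a | s ∉ F.carrier}, F.carrier
  have hU : IsClosed U :=
    (Set.toFinite {F : Face a | s ∉ F.carrier}).isClosed_biUnion fun F _ => F.isClosed_carrier
  have hsU : c t₀ ∈ Uᶜ := by
    rw [hc0]
    simp only [U, Set.mem_compl_iff, Set.mem_iUnion, not_exists]
    exact fun F hF h => hF h
  have hnhds : c ⁻¹' Uᶜ ∈ nhds t₀ :=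
    hc.continuousAt.preimage_mem_nhds (hU.isOpen_compl.mem_nhds hsU)
  obtain ⟨δ, hδ, hball⟩ := Metric.mem_nhds_iff.1 hnhds
  let t : Set.Icc (0 : ℝ) ε := ⟨min ε (δ / 2), (lt_min hε (half_pos hδ)).le, min_le_left _ _⟩
  have ht0 : 0 < (t : ℝ) := lt_min hε (half_pos hδ)
  have ht : c t ∈ Uᶜ := hball (by
    rw [Metric.mem_ball, Subtype.dist_eq, Real.dist_eq]
    simp only [t₀, sub_zero]
    rw [abs_of_pos ht0]
    exact (min_le_right _ _).trans_lt (half_lt_self hδ))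
  have hsup : c t ∈ T.support := (φ.symm (p t)).2
  simp only [Subcomplex.support, Set.mem_iUnion] at hsup
  obtain ⟨F, hF, hcF⟩ := hsup
  refine ⟨t, ht0, F, hF, ?_, c t, hcF, ?_⟩
  · by_contra hsF
    exact ht (Set.mem_biUnion (show F ∈ {F : Face a | s ∉ F.carrier} from hsF) hcF)
  · rw [hcp, proj_add, proj_smul]

/-- The hypotheses on the angles. -/
structure Angles (θ : Fin n → ℝ) : Prop where
  strictMono : StrictMono θ
  pos : ∀ i, 0 < θ i
  lt_pi : ∀ i, θ i < Real.pi

theorem Angles.sin_pos (hθ : Angles θ) (i : Fin n) : 0 < Real.sin (θ i) :=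
  Real.sin_pos_of_pos_of_lt_pi (hθ.pos i) (hθ.lt_pi i)

theorem Angles.sin_sub_pos (hθ : Angles θ) {j k : Fin n} (h : j < k) :
    0 < Real.sin (θ k - θ j) :=
  Real.sin_pos_of_pos_of_lt_pi (sub_pos.2 (hθ.strictMono h)) (by
    have := hθ.pos j; have := hθ.lt_pi k; linarith)

theorem proj_eq_of_eq_off {s x : Fin n → ℝ} {j k : Fin n} (hjk : j ≠ k)
    (h : ∀ i, i ≠ j → i ≠ k → x i = s i) :
    proj θ x = proj θ s + ((x j - s j) * Real.cos (θ j) + (x k - s k) * Real.cos (θ k),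
      (x j - s j) * Real.sin (θ j) + (x k - s k) * Real.sin (θ k)) := by
  have : x = s + (Pi.single j (x j - s j) + Pi.single k (x k - s k)) := by
    funext i
    rcases eq_or_ne i j with rfl | hj
    · simp [hjk]
    · rcases eq_or_ne i k with rfl | hk
      · simp [hj]
      · simp [hj, hk, h i hj hk]
  conv_lhs => rw [this]
  rw [proj_add, proj_add, proj_single, proj_single]
  rfl

/-- A face that contains a horizontal segment is a rhombus. -/
theorem Face.exists_dirs_eq (hθ : Angles θ) {F : Face a} (hF : F.dirs.card ≤ 2)
    {s x : Fin n → ℝ} (hs : s ∈ F.carrier) (hx : x ∈ F.carrier) {c : ℝ} (hc : 0 < c)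
    (h : proj θ x = proj θ s + (-c, 0)) :
    ∃ j k, j < k ∧ F.dirs = {j, k} ∧ x j < s j ∧ s k < x k := by
  have hout : ∀ i, i ∉ F.dirs → x i = s i := fun i hi => by
    have h1 := hs i; have h2 := hx i
    simp only [hi, if_false, add_zero] at h1 h2
    linarith [h1.1, h1.2, h2.1, h2.2]
  have main : ∀ j k, j < k → (∀ i, i ≠ j → i ≠ k → x i = s i) → x j < s j ∧ s k < x k := by
    intro j k hjk hoff
    rw [proj_eq_of_eq_off hjk.ne hoff] at h
    have h' := add_left_cancel h
    rw [Prod.mk.injEq] at h'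
    obtain ⟨h1, h2⟩ := h'
    have hj := hθ.sin_pos j
    have hk := hθ.sin_pos k
    have hjk' := hθ.sin_sub_pos hjk
    -- Cramer's rule for the two coordinate displacements; all the sines are positive.
    have h3 : (x k - s k) * Real.sin (θ k - θ j) = c * Real.sin (θ j) := by
      rw [Real.sin_sub]
      linear_combination Real.cos (θ j) * h2 - Real.sin (θ j) * h1
    have h4 : (s j - x j) * Real.sin (θ k - θ j) = c * Real.sin (θ k) := by
      rw [Real.sin_sub]
      linear_combination Real.cos (θ k) * h2 - Real.sin (θ k) * h1
    have h5 := pos_of_mul_pos_left (h3 ▸ mul_pos hc hj) hjk'.le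
    have h6 := pos_of_mul_pos_left (h4 ▸ mul_pos hc hk) hjk'.le
    exact ⟨by linarith, by linarith⟩
  have hne : x ≠ s := by
    rintro rfl
    have := congrArg Prod.fst h
    simp only [Prod.fst_add] at this
    linarith
  -- An edge cannot contain the segment, since no edge direction is horizontal.
  have hcard : F.dirs.card = 2 := by
    by_contra hcard
    obtain ⟨j, hj⟩ : ∃ j, F.dirs ⊆ {j} := by
      rcases Nat.lt_or_ge 0 F.dirs.card with h0 | h0
      · obtain ⟨j, hj⟩ := Finset.card_eq_one.1 (show F.dirs.card = 1 by omega)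
        exact ⟨j, hj.subset⟩
      · obtain ⟨j, -⟩ := Function.ne_iff.1 hne
        exact ⟨j, by simp [Finset.card_eq_zero.1 (Nat.le_zero.1 h0)]⟩
    have hxs : x = s + Pi.single j (x j - s j) := by
      funext i
      rcases eq_or_ne i j with rfl | hij
      · simp
      · simp [hij, hout i fun hi => hij (Finset.mem_singleton.1 (hj hi))]
    have h2 : proj θ s + proj θ (Pi.single j (x j - s j)) = proj θ s + (-c, 0) := by
      rw [← proj_add, ← hxs, h]
    have h3 := add_left_cancel h2
    rw [proj_single, Prod.mk.injEq] at h3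
    have h4 := (mul_eq_zero.1 h3.2).resolve_right (hθ.sin_pos j).ne'
    apply hne
    rw [hxs, h4]
    simp
  obtain ⟨j, k, hjk, hD⟩ := Finset.card_eq_two.1 hcard
  rcases lt_or_gt_of_ne hjk with hlt | hlt
  · exact ⟨j, k, hlt, hD, main j k hlt fun i h1 h2 => hout i (by simp [hD, h1, h2])⟩
  · exact ⟨k, j, hlt, by rw [hD, Finset.pair_comm],
      main k j hlt fun i h1 h2 => hout i (by simp [hD, h1, h2])⟩

theorem horizontal_apply (j k i : Fin n) : horizontal θ j k i =
    (if i = k then Real.sin (θ j) else 0) - (if i = j then Real.sin (θ k) else 0) := by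
  simp [horizontal, Pi.single_apply]

theorem add_smul_horizontal_mem (hθ : Angles θ) {j k : Fin n} (hjk : j < k) {s l r : Fin n → ℝ}
    (hs : ∀ i, l i ≤ s i ∧ s i ≤ r i) {t δ : ℝ} (ht : 0 ≤ t) (htδ : t ≤ δ) (hj : l j + δ ≤ s j)
    (hk : s k + δ ≤ r k) (i : Fin n) :
    l i ≤ (s + t • horizontal θ j k) i ∧ (s + t • horizontal θ j k) i ≤ r i := by
  have hsj := hθ.sin_pos j
  have hsk := hθ.sin_pos k
  have h1 : t * Real.sin (θ j) ≤ t := mul_le_of_le_one_right ht (Real.sin_le_one _)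
  have h2 : t * Real.sin (θ k) ≤ t := mul_le_of_le_one_right ht (Real.sin_le_one _)
  have h3 : 0 ≤ t * Real.sin (θ j) := mul_nonneg ht hsj.le
  have h4 : 0 ≤ t * Real.sin (θ k) := mul_nonneg ht hsk.le
  rw [Pi.add_apply, Pi.smul_apply, smul_eq_mul, horizontal_apply]
  have hsi := hs i
  rcases eq_or_ne i j with rfl | hij
  · simp only [hjk.ne, if_true, if_false, zero_sub, mul_neg]
    constructor <;> linarith
  · rcases eq_or_ne i k with rfl | hik
    · simp only [hjk.ne', if_true, if_false, sub_zero]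
      constructor <;> linarith
    · simpa [hij, hik] using hsi

/-- The margins let `s` move along `horizontal θ j k` inside the box. The rhombus found may have
other directions than `j, k`. A margin of `1 / 2` serves both vertices and edge midpoints. -/
theorem Subcomplex.IsTiling.exists_rhombus (hT : T.IsTiling θ) (hθ : Angles θ) {s : Fin n → ℝ}
    (hs : s ∈ T.support) {j k : Fin n} (hjk : j < k) (hj : 1 / 2 ≤ s j) (hk : s k + 1 / 2 ≤ a k) :
    ∃ F ∈ T.faces, ∃ j' k', j' < k' ∧ F.dirs = {j', k'} ∧ s ∈ F.carrier ∧
      ∃ x ∈ F.carrier, x j' < s j' ∧ s k' < x k' := by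
  have hbox := T.support_subset hs
  obtain ⟨t, ht, F, hF, hsF, x, hx, hpx⟩ := hT.exists_face (d := horizontal θ j k) hs
    (ε := 1 / 2) (by norm_num) fun t ht htε => by
      have := add_smul_horizontal_mem hθ hjk (l := 0) (r := fun i => (a i : ℝ))
        (fun i => ⟨hbox.1 i, hbox.2 i⟩) ht htε (by simpa using hj) hk
      exact ⟨fun i => (this i).1, fun i => (this i).2⟩
  obtain ⟨j', k', hjk', hD, h1, h2⟩ := Face.exists_dirs_eq hθ (hT.1 F hF) hsF hx
    (mul_pos ht (hθ.sin_sub_pos hjk)) (by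
      simp [hpx, proj_horizontal])
  exact ⟨F, hF, j', k', hjk', hD, hsF, x, hx, h1, h2⟩

theorem Subcomplex.HasFace.mem_support {I : Fin n → ℕ} {D : Finset (Fin n)} (h : T.HasFace I D)
    {x : Fin n → ℝ} (hx : ∀ i, (I i : ℝ) ≤ x i ∧ x i ≤ (I i : ℝ) + (if i ∈ D then 1 else 0)) :
    x ∈ T.support := by
  obtain ⟨F, hF, rfl, rfl⟩ := h
  exact Set.mem_biUnion hF hx

/-- Every vertex off the left boundary is the right vertex of a rhombus. -/
theorem Subcomplex.IsTiling.exists_rhombus_vertex (hT : T.IsTiling θ) (hθ : Angles θ)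
    {I : Fin n → ℕ} (hI : I ∈ T.vert) {j k : Fin n} (hjk : j < k) (hj : 0 < I j) (hk : I k < a k) :
    ∃ j' k' J, j' < k' ∧ I = J + e j' ∧ T.HasFace J {j', k'} := by
  have hs : (fun i => (I i : ℝ)) ∈ T.support :=
    (mem_vert_iff.1 hI).mem_support fun i => by simp
  have hj' : (1 : ℝ) ≤ I j := by exact_mod_cast hj
  have hk' : (I k : ℝ) + 1 ≤ a k := by exact_mod_cast hk
  obtain ⟨F, hF, j', k', hlt, hD, hsF, x, hx, h1, h2⟩ :=
    hT.exists_rhombus hθ hs hjk (by linarith) (by linarith)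
  refine ⟨j', k', F.base, hlt, ?_, F, hF, rfl, hD⟩
  funext i
  have hsi : (F.base i : ℝ) ≤ I i ∧ (I i : ℝ) ≤ F.base i + (if i ∈ F.dirs then 1 else 0) := hsF i
  have hxi := hx i
  rw [hD] at hsi hxi
  rw [Pi.add_apply]
  rcases eq_or_ne i j' with rfl | hij
  · rw [e_self]
    simp only [Finset.mem_insert_self, if_true] at hsi
    have h3 : F.base i < I i := by exact_mod_cast hxi.1.trans_lt h1
    have h4 : I i ≤ F.base i + 1 := by exact_mod_cast hsi.2
    omega
  · rw [e_ne hij, add_zero]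
    have h3 : F.base i ≤ I i := by exact_mod_cast hsi.1
    rcases eq_or_ne i k' with rfl | hik
    · simp only [Finset.mem_insert, Finset.mem_singleton, or_true, if_true] at hxi
      have h4 : I i < F.base i + 1 := by exact_mod_cast h2.trans_le hxi.2
      omega
    · simp only [Finset.mem_insert, Finset.mem_singleton, hij, hik, or_self, if_false,
        add_zero] at hsi
      have h4 : I i ≤ F.base i := by exact_mod_cast hsi.2
      omega

/-- Every edge off the left boundary has a rhombus on its left. -/
theorem Subcomplex.IsTiling.exists_rhombus_edge (hT : T.IsTiling θ) (hθ : Angles θ)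
    {I : Fin n → ℕ} {o : Fin n} (hI : T.HasFace I {o})
    (h : (∃ k, o < k ∧ I k < a k) ∨ ∃ j, j < o ∧ 0 < I j) :
    (∃ k, o < k ∧ T.HasFace I {o, k}) ∨ ∃ j J, j < o ∧ I = J + e j ∧ T.HasFace J {j, o} := by
  let s : Fin n → ℝ := fun i => (I i : ℝ) + if i = o then 1 / 2 else 0
  have so : s o = I o + 1 / 2 := by simp [s]
  have sne : ∀ i, i ≠ o → s i = I i := fun i hi => by simp [s, hi]
  have hs : s ∈ T.support := hI.mem_support fun i => by
    rcases eq_or_ne i o with rfl | hi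
    · rw [so]; simp only [Finset.mem_singleton, if_true]; constructor <;> linarith
    · simp [sne i hi, hi]
  have hIo : (I o : ℝ) + 1 ≤ a o := by
    have := hI.le o
    simp only [Finset.mem_singleton, if_true] at this
    exact_mod_cast this
  obtain ⟨F, hF, j, k, hjk, hD, hsF, x, hx, h1, h2⟩ :
      ∃ F ∈ T.faces, ∃ j' k', j' < k' ∧ F.dirs = {j', k'} ∧ s ∈ F.carrier ∧
      ∃ x ∈ F.carrier, x j' < s j' ∧ s k' < x k' := by
    rcases h with ⟨k, hk, hak⟩ | ⟨j, hj, hIj⟩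
    · have h1 : (I k : ℝ) + 1 ≤ a k := by exact_mod_cast hak
      have h2 : (0 : ℝ) ≤ I o := Nat.cast_nonneg _
      exact hT.exists_rhombus hθ hs hk (by rw [so]; linarith)
        (by rw [sne k hk.ne']; linarith)
    · have h1 : (1 : ℝ) ≤ I j := by exact_mod_cast hIj
      exact hT.exists_rhombus hθ hs hj (by rw [sne j hj.ne]; linarith)
        (by rw [so]; linarith)
  -- The midpoint has a half-integral `o`-coordinate, which a face not spanning `o` cannot contain.
  have hoD : o ∈ F.dirs := by
    by_contra hoD
    have := hsF o
    simp only [hoD, if_false, add_zero, so] at this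
    have h3 : (F.base o : ℝ) = I o + 1 / 2 := le_antisymm this.1 this.2
    have h4 : 2 * F.base o = 2 * I o + 1 := by
      have : (2 * F.base o : ℝ) = 2 * I o + 1 := by linarith
      exact_mod_cast this
    omega
  have hbo : I o = F.base o := by
    have := hsF o
    simp only [hoD, if_true, so] at this
    have h3 : F.base o < I o + 1 := by
      have : (F.base o : ℝ) < I o + 1 := by linarith
      exact_mod_cast this
    have h4 : I o < F.base o + 1 := by
      have : (I o : ℝ) < F.base o + 1 := by linarith
      exact_mod_cast this
    omega
  have hbase : ∀ i, i ≠ o → F.base i ≤ I i := fun i hi => by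
    have := (hsF i).1
    rw [sne i hi] at this
    exact_mod_cast this
  have hoff : ∀ i, i ∉ F.dirs → I i = F.base i := fun i hi => by
    have hio : i ≠ o := fun h => hi (h ▸ hoD)
    refine le_antisymm ?_ (hbase i hio)
    have := (hsF i).2
    simp only [sne i hio, hi, if_false, add_zero] at this
    exact_mod_cast this
  have hjo : j ∈ F.dirs := by simp [hD]
  have hko : k ∈ F.dirs := by simp [hD]
  rw [hD, Finset.mem_insert, Finset.mem_singleton] at hoD
  rcases hoD with rfl | rfl
  · refine Or.inl ⟨k, hjk, F, hF, ?_, hD⟩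
    funext i
    by_cases hi : i ∈ F.dirs
    · rw [hD, Finset.mem_insert, Finset.mem_singleton] at hi
      rcases hi with rfl | rfl
      · exact hbo.symm
      · refine le_antisymm (hbase i hjk.ne') ?_
        have h3 := (hx i).2
        rw [sne i hjk.ne'] at h2
        simp only [hko, if_true] at h3
        have : I i < F.base i + 1 := by exact_mod_cast h2.trans_le h3
        omega
    · exact (hoff i hi).symm
  · refine Or.inr ⟨j, F.base, hjk, ?_, F, hF, rfl, hD⟩
    funext i
    rw [Pi.add_apply]
    by_cases hi : i ∈ F.dirs
    · rw [hD, Finset.mem_insert, Finset.mem_singleton] at hi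
      rcases hi with rfl | rfl
      · rw [e_self]
        rw [sne i hjk.ne] at h1
        have h3 : F.base i < I i := by exact_mod_cast (hx i).1.trans_lt h1
        have h4 := (hsF i).2
        simp only [sne i hjk.ne, hjo, if_true] at h4
        have h5 : I i ≤ F.base i + 1 := by exact_mod_cast h4
        omega
      · rw [e_ne hjk.ne', add_zero, hbo]
    · have hij : i ≠ j := fun h => hi (h ▸ hjo)
      rw [e_ne hij, add_zero, hoff i hi]

/-- The negative coordinate identifies `j` and the positive one identifies `k`. -/
theorem horizontal_inj (hθ : Angles θ) {j k j' k' : Fin n} (hjk : j < k) {t t' : ℝ}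
    (ht : 0 < t) (h : t • horizontal θ j k = t' • horizontal θ j' k') (ht' : 0 < t') :
    j = j' ∧ k = k' := by
  have h1 := congrFun h j
  have h2 := congrFun h k
  have hj := mul_pos ht (hθ.sin_pos j)
  have hk := mul_pos ht (hθ.sin_pos k)
  have hj' := mul_pos ht' (hθ.sin_pos j')
  have hk' := mul_pos ht' (hθ.sin_pos k')
  simp only [Pi.smul_apply, smul_eq_mul, horizontal_apply, hjk.ne, hjk.ne', if_true, if_false,
    zero_sub, sub_zero, mul_neg, mul_sub, mul_ite, mul_zero] at h1 h2
  constructor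
  · by_contra hne
    rw [if_neg hne] at h1
    split_ifs at h1 <;> linarith
  · by_contra hne
    rw [if_neg hne] at h2
    split_ifs at h2 <;> linarith

/-- A rhombus of a tiling is determined by its right vertex. -/
theorem Subcomplex.IsTiling.right_unique (hT : T.IsTiling θ) (hθ : Angles θ)
    {I J : Fin n → ℕ} {j k j' k' : Fin n} (hjk : j < k) (hjk' : j' < k')
    (hI : T.HasFace I {j, k}) (hJ : T.HasFace J {j', k'}) (h : I + e j = J + e j') :
    j = j' ∧ k = k' := by
  have mem : ∀ {I : Fin n → ℕ} {j k : Fin n}, j < k → T.HasFace I {j, k} → ∀ t : ℝ, 0 ≤ t →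
      t ≤ 1 → (fun i => ((I + e j) i : ℝ)) + t • horizontal θ j k ∈ T.support := by
    intro I j k hjk hI t ht ht1
    refine hI.mem_support (add_smul_horizontal_mem hθ hjk (fun i => ?_) ht ht1 ?_ ?_)
    · rcases eq_or_ne i j with rfl | hij
      · simp [e_self]
      · simp only [Pi.add_apply, e_ne hij, add_zero, le_refl, true_and]
        split_ifs <;> simp
    · simp [e_self]
    · simp [e_ne hjk.ne']
  have ht := hθ.sin_sub_pos hjk
  have ht' := hθ.sin_sub_pos hjk'
  -- Each rhombus contains a leftward segment from the common vertex. Crossing the two sines as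
  -- parameters gives equal projections, so injectivity identifies the points.
  have heq := hT.injOn (mem hjk hI _ ht'.le (Real.sin_le_one _))
    (mem hjk' hJ _ ht.le (Real.sin_le_one _)) (by
      simp only [proj_add, proj_smul, proj_horizontal, h, Prod.smul_mk, smul_eq_mul, mul_neg,
        mul_zero, mul_comm (Real.sin (θ k - θ j)) (Real.sin _)])
  rw [h] at heq
  exact horizontal_inj hθ hjk ht' (add_left_cancel heq) ht

/-- A rhombus of a tiling is determined by its left vertex. -/
theorem Subcomplex.IsTiling.left_unique (hT : T.IsTiling θ) (hθ : Angles θ)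
    {I J : Fin n → ℕ} {j k j' k' : Fin n} (hjk : j < k) (hjk' : j' < k')
    (hI : T.HasFace I {j, k}) (hJ : T.HasFace J {j', k'}) (h : I + e k = J + e k') :
    j = j' ∧ k = k' := by
  have mem : ∀ {I : Fin n → ℕ} {j k : Fin n}, j < k → T.HasFace I {j, k} → ∀ t : ℝ, 0 ≤ t →
      t ≤ 1 → (fun i => ((I + e k) i : ℝ)) + -(t • horizontal θ j k) ∈ T.support := by
    intro I j k hjk hI t ht ht1
    refine hI.mem_support fun i => ?_
    -- Negating the coordinates turns rightward motion from a left vertex into the previous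
    -- situation.
    have := add_smul_horizontal_mem hθ hjk (s := fun i => -((I + e k) i : ℝ))
      (l := fun i => -((I i : ℝ) + (if i ∈ ({j, k} : Finset (Fin n)) then 1 else 0)))
      (r := fun i => -(I i : ℝ)) (fun i => ?_) ht ht1 ?_ ?_ i
    · simp only [Pi.add_apply, Pi.neg_apply] at this ⊢
      constructor <;> linarith [this.1, this.2]
    · rcases eq_or_ne i k with rfl | hik
      · simp [e_self]
      · simp only [Pi.add_apply, e_ne hik, add_zero, le_refl, and_true]
        split_ifs <;> simp
    · simp [e_ne hjk.ne]
    · simp [e_self]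
  have ht := hθ.sin_sub_pos hjk
  have ht' := hθ.sin_sub_pos hjk'
  have heq := hT.injOn (mem hjk hI _ ht'.le (Real.sin_le_one _))
    (mem hjk' hJ _ ht.le (Real.sin_le_one _)) (by
      simp only [← neg_smul, proj_add, proj_smul, proj_horizontal, h, Prod.smul_mk, smul_eq_mul,
        neg_mul_neg, mul_zero, mul_comm (Real.sin (θ k - θ j))])
  rw [h] at heq
  exact horizontal_inj hθ hjk ht' (neg_injective (add_left_cancel heq)) ht

/-- The right boundary belongs to every tiling. -/
theorem Subcomplex.IsTiling.hasFace_boundary (hT : T.IsTiling θ) (hθ : Angles θ)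
    {I : Fin n → ℕ} {o : Fin n} (ho : I o < a o) (hlo : ∀ i, i < o → I i = a i)
    (hhi : ∀ i, o < i → I i = 0) : T.HasFace I {o} := by
  let s : Fin n → ℝ := fun i => (I i : ℝ) + if i = o then 1 / 2 else 0
  have so : s o = I o + 1 / 2 := by simp [s]
  have sne : ∀ i, i ≠ o → s i = I i := fun i hi => by simp [s, hi]
  have ho' : (I o : ℝ) + 1 ≤ a o := by exact_mod_cast ho
  have hsbox : s ∈ Set.Icc 0 (fun i => (a i : ℝ)) := by
    refine ⟨fun i => add_nonneg (Nat.cast_nonneg _) (by split_ifs <;> norm_num), fun i => ?_⟩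
    rcases lt_trichotomy i o with hi | rfl | hi
    · rw [sne i hi.ne, hlo i hi]
    · rw [so]; linarith
    · rw [sne i hi.ne', hhi i hi]; simp
  obtain ⟨y, hy, hproj⟩ := hT.exists_proj_eq hsbox
  have hybox := T.support_subset hy
  rw [proj, proj, Prod.mk.injEq] at hproj
  -- The functional with coefficients `sin (θ o - θ i)` factors through the projection and measures
  -- displacement transverse to direction `o`. The boundary point `s` maximizes it on the box, so
  -- every summand vanishes.
  have hsum : ∑ i, (y i - s i) * Real.sin (θ o - θ i) = 0 := by
    have h1 : ∑ i, (y i - s i) * Real.cos (θ i) = 0 := by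
      simp only [sub_mul, Finset.sum_sub_distrib, hproj.1, sub_self]
    have h2 : ∑ i, (y i - s i) * Real.sin (θ i) = 0 := by
      simp only [sub_mul, Finset.sum_sub_distrib, hproj.2, sub_self]
    have : ∀ i, (y i - s i) * Real.sin (θ o - θ i) = Real.sin (θ o) * ((y i - s i) *
        Real.cos (θ i)) - Real.cos (θ o) * ((y i - s i) * Real.sin (θ i)) := fun i => by
      rw [Real.sin_sub]; ring
    rw [Finset.sum_congr rfl fun i _ => this i, Finset.sum_sub_distrib, ← Finset.mul_sum,
      ← Finset.mul_sum, h1, h2, mul_zero, mul_zero, sub_zero]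
  have hterm : ∀ i ∈ Finset.univ, (y i - s i) * Real.sin (θ o - θ i) ≤ 0 := by
    intro i _
    rcases lt_trichotomy i o with hi | rfl | hi
    · refine mul_nonpos_of_nonpos_of_nonneg ?_ (hθ.sin_sub_pos hi).le
      rw [sne i hi.ne, hlo i hi, sub_nonpos]
      exact hybox.2 i
    · simp
    · refine mul_nonpos_of_nonneg_of_nonpos ?_ ?_
      · rw [sne i hi.ne', hhi i hi, Nat.cast_zero, sub_zero]
        exact hybox.1 i
      · rw [← neg_sub, Real.sin_neg, neg_nonpos]
        exact (hθ.sin_sub_pos hi).le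
  have hzero := (Finset.sum_eq_zero_iff_of_nonpos hterm).1 hsum
  have hys : ∀ i, i ≠ o → y i = s i := fun i hi => by
    have h1 := (mul_eq_zero.1 (hzero i (Finset.mem_univ i))).resolve_right (by
      rcases lt_or_gt_of_ne hi with hi | hi
      · exact (hθ.sin_sub_pos hi).ne'
      · rw [← neg_sub, Real.sin_neg]
        exact (neg_neg_of_pos (hθ.sin_sub_pos hi)).ne)
    exact sub_eq_zero.1 h1
  have hyo : y o = s o := by
    have h2 : ∑ i, (y i - s i) * Real.sin (θ i) = 0 := by
      simp only [sub_mul, Finset.sum_sub_distrib, hproj.2, sub_self]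
    rw [Finset.sum_eq_single o (fun i _ hi => by rw [hys i hi, sub_self, zero_mul])
      (fun h => absurd (Finset.mem_univ o) h)] at h2
    exact sub_eq_zero.1 ((mul_eq_zero.1 h2).resolve_right (hθ.sin_pos o).ne')
  have hyes : y = s := funext fun i => by
    rcases eq_or_ne i o with rfl | hi
    · exact hyo
    · exact hys i hi
  rw [hyes] at hy
  simp only [Subcomplex.support, Set.mem_iUnion] at hy
  obtain ⟨F, hF, hsF⟩ := hy
  have hle : ∀ i, F.base i ≤ I i := fun i => by
    have := (hsF i).1
    rcases eq_or_ne i o with rfl | hi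
    · rw [so] at this
      have h3 : F.base i < I i + 1 := by
        have : (F.base i : ℝ) < I i + 1 := by linarith
        exact_mod_cast this
      omega
    · rw [sne i hi] at this
      exact_mod_cast this
  refine hasFace_of_le hF hle fun i => ?_
  have h1 := (hsF i).2
  rcases eq_or_ne i o with rfl | hi
  · rw [so] at h1
    simp only [Finset.mem_singleton, if_true]
    have := hle i
    split_ifs at h1 ⊢ with hD
    · have : I i < F.base i + 1 := by
        have : (I i : ℝ) < F.base i + 1 := by linarith
        exact_mod_cast this
      omega
    · have : (F.base i : ℝ) ≤ I i := by exact_mod_cast this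
      linarith
  · rw [sne i hi] at h1
    simp only [Finset.mem_singleton, hi, if_false, add_zero]
    split_ifs at h1 ⊢ <;> exact_mod_cast h1

end Geometry

/-! ### Sweeping a tiling from its right to its left boundary. -/

section Sweeping

variable {n : ℕ} {a : Fin n → ℕ} {T : Subcomplex a} {θ : Fin n → ℝ}

/-- All edges of the lattice path from `I` with steps `w` belong to `T`. -/
def Subcomplex.HasPath (T : Subcomplex a) : (Fin n → ℕ) → List (Fin n) → Prop
  | _, [] => True
  | I, o :: w => T.HasFace I {o} ∧ T.HasPath (I + e o) w

theorem Subcomplex.hasPath_append {I : Fin n → ℕ} {u v : List (Fin n)} :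
    T.HasPath I (u ++ v) ↔ T.HasPath I u ∧ T.HasPath (I + cnt u) v := by
  induction u generalizing I with
  | nil => simp [HasPath, cnt_nil]
  | cons o u ih => simp [HasPath, ih, cnt_cons, and_assoc, add_assoc]

theorem Subcomplex.HasPath.hasFace {u v : List (Fin n)} {o : Fin n}
    (h : T.HasPath 0 (u ++ o :: v)) : T.HasFace (cnt u) {o} := by
  have := (hasPath_append.1 h).2.1
  rwa [zero_add] at this

theorem Subcomplex.HasFace.lower {I : Fin n → ℕ} {j k : Fin n} (h : T.HasFace I {j, k}) :
    T.HasFace I {k} :=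
  h.mono (fun _ => le_rfl) fun i => by
    by_cases hk : i = k <;> simp [hk]

theorem Subcomplex.HasFace.upper {I : Fin n → ℕ} {j k : Fin n} (hjk : j ≠ k)
    (h : T.HasFace I {j, k}) : T.HasFace (I + e k) {j} :=
  h.mono (fun i => by simp) fun i => by
    rcases eq_or_ne i k with rfl | hk
    · simp [e_self, hjk.symm]
    · simp [e_ne hk, hk]

theorem Subcomplex.HasFace.left_mem_vert {I : Fin n → ℕ} {j k : Fin n} (h : T.HasFace I {j, k}) :
    I + e k ∈ T.vert :=
  mem_vert_iff.2 (h.mono (fun i => by simp) fun i => by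
    rcases eq_or_ne i k with rfl | hk
    · simp [e_self]
    · simp [e_ne hk])

theorem Subcomplex.HasFace.start_mem_vert {I : Fin n → ℕ} {D : Finset (Fin n)}
    (h : T.HasFace I D) : I ∈ T.vert :=
  mem_vert_iff.2 (h.mono (fun _ => le_rfl) fun i => by simp)

theorem Subcomplex.HasFace.lt {I : Fin n → ℕ} {D : Finset (Fin n)} (h : T.HasFace I D)
    {i : Fin n} (hi : i ∈ D) : I i < a i := by
  have := h.le i
  rw [if_pos hi] at this
  omega

/-- A swap of a path along a rhombus of `T`. -/
theorem Subcomplex.HasPath.swap {u v : List (Fin n)} {j k : Fin n} (hjk : j < k)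
    (hF : T.HasFace (cnt u) {j, k}) (h : T.HasPath 0 (u ++ j :: k :: v)) :
    T.HasPath 0 (u ++ k :: j :: v) := by
  rw [hasPath_append, zero_add] at h ⊢
  obtain ⟨h1, -, -, h2⟩ := h
  exact ⟨h1, hF.lower, hF.upper hjk.ne, by rwa [add_right_comm]⟩

/-- The current path edge is the lower right edge of a rhombus. If the next edge is an upper right
edge, its rhombus has the same right vertex, so both edges bound one rhombus and can be swapped;
otherwise continue upward. The walk stops because at the last edge direction `i` is already used up.
-/
theorem Subcomplex.IsTiling.exists_swap_of_up (hT : T.IsTiling θ) (hθ : Angles θ)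
    (v : List (Fin n)) : ∀ (u : List (Fin n)) (o i : Fin n), o < i → T.HasFace (cnt u) {o, i} →
      T.HasPath 0 (u ++ o :: v) → cnt (u ++ o :: v) = a →
      ∃ u' v' j k, j < k ∧ u ++ o :: v = u' ++ j :: k :: v' ∧ T.HasFace (cnt u') {j, k} := by
  induction v with
  | nil =>
    intro u o i hoi hF _ ha
    have h1 := congrFun ha i
    have h2 := hF.lt (i := i) (by simp)
    rw [cnt_concat, Pi.add_apply, e_ne hoi.ne'] at h1
    omega
  | cons o' v ih =>
    intro u o i hoi hF hp ha
    have hoi' := hF.lt (i := i) (by simp)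
    have heq : u ++ o :: o' :: v = (u ++ [o]) ++ o' :: v := by simp
    have hp' := hp
    rw [heq] at hp'
    have hface := hp'.hasFace
    rw [cnt_concat] at hface
    rcases hT.exists_rhombus_edge hθ hface (by
      rcases lt_or_ge o' i with h | h
      · exact Or.inl ⟨i, h, by simpa [e_ne hoi.ne'] using hoi'⟩
      · exact Or.inr ⟨o, hoi.trans_le h, by simp [e_self]⟩) with ⟨k, hk, hF'⟩ | ⟨j, J, hj, hJ, hF'⟩
    · rw [heq] at ha ⊢
      exact ih _ o' k hk (by rwa [cnt_concat]) hp' ha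
    · obtain ⟨rfl, rfl⟩ := hT.right_unique hθ hoi hj hF hF' hJ
      exact ⟨u, v, _, _, hoi, rfl, hF⟩

/-- The mirror walk: from an upper right edge go down until a lower right edge appears. It stops
because the origin is not the right vertex of any rhombus. -/
theorem Subcomplex.IsTiling.exists_swap_of_down (hT : T.IsTiling θ) (hθ : Angles θ)
    (u : List (Fin n)) : ∀ (v : List (Fin n)) (o i : Fin n) (J : Fin n → ℕ), i < o →
      cnt u = J + e i → T.HasFace J {i, o} → T.HasPath 0 (u ++ o :: v) →
      ∃ u' v' j k, j < k ∧ u ++ o :: v = u' ++ j :: k :: v' ∧ T.HasFace (cnt u') {j, k} := by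
  induction u using List.reverseRecOn with
  | nil =>
    intro v o i J _ h
    have := congrFun h i
    simp [cnt_nil, e_self] at this
  | append_singleton u o' ih =>
    intro v o i J hio h hF hp
    have heq : u ++ [o'] ++ o :: v = u ++ o' :: o :: v := by simp
    rw [heq] at hp ⊢
    rw [cnt_concat] at h
    have ho := hF.lt (i := o) (by simp)
    have h1 := congrFun h o
    have h2 := congrFun h i
    simp only [Pi.add_apply, e_self, e_ne hio.ne'] at h1 h2
    rcases hT.exists_rhombus_edge hθ hp.hasFace (by
      rcases lt_or_ge o' o with h | h
      · exact Or.inl ⟨o, h, by omega⟩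
      · have hne := hio.trans_le h
        rw [e_ne hne.ne] at h2
        exact Or.inr ⟨i, hne, by omega⟩) with ⟨k, hk, hF'⟩ | ⟨j, J', hj, hJ', hF'⟩
    · obtain ⟨rfl, rfl⟩ := hT.right_unique hθ hk hio hF' hF h
      exact ⟨u, v, _, _, hk, rfl, hF'⟩
    · exact ih (o :: v) o' j J' hj hJ' hF' hp

/-- A path in a tiling can be moved to the left across a rhombus, unless it is the left
boundary. -/
theorem Subcomplex.IsTiling.exists_swap (hT : T.IsTiling θ) (hθ : Angles θ) {w : List (Fin n)}
    (hp : T.HasPath 0 w) (ha : cnt w = a) (hw : ¬ w.Pairwise (· ≥ ·)) :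
    ∃ u v j k, j < k ∧ w = u ++ j :: k :: v ∧ T.HasFace (cnt u) {j, k} := by
  obtain ⟨u, v, j, k, hjk, rfl⟩ := exists_ascent hw
  have hk : cnt u k < a k := by
    rw [← ha, cnt_append, cnt_cons, cnt_cons]
    simp only [Pi.add_apply, e_self]
    omega
  rcases hT.exists_rhombus_edge hθ hp.hasFace (Or.inl ⟨k, hjk, hk⟩) with
    ⟨i, hi, hF⟩ | ⟨i, J, hi, hJ, hF⟩
  · exact hT.exists_swap_of_up hθ _ u j i hi hF hp ha
  · exact hT.exists_swap_of_down hθ u _ j i J hi hJ hF hp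

theorem Subcomplex.IsTiling.exists_sweep_of_sweep (hT : T.IsTiling θ) (hθ : Angles θ)
    {w₀ w : List (Fin n)} {A : Set (Fin n → ℕ)}
    (h : Sweep (fun I j k => T.HasFace I {j, k}) w₀ A w) (hp : T.HasPath 0 w) (ha : cnt w = a) :
    ∃ A' w', Sweep (fun I j k => T.HasFace I {j, k}) w₀ A' w' ∧ w'.Pairwise (· ≥ ·) := by
  by_cases hw : w.Pairwise (· ≥ ·)
  · exact ⟨A, w, h, hw⟩
  · obtain ⟨u, v, j, k, hjk, rfl, hF⟩ := hT.exists_swap hθ hp ha hw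
    have := Step.ascents_lt ⟨u, v, j, k, hjk, rfl, rfl⟩
    exact hT.exists_sweep_of_sweep hθ (h.step hjk hF) (hp.swap hjk hF) ((cnt_swap _ _ _ _).trans ha)
termination_by ascents w

/-- The right boundary is a path in every tiling. -/
theorem Subcomplex.IsTiling.hasPath_sorted (hT : T.IsTiling θ) (hθ : Angles θ)
    (v : List (Fin n)) : ∀ u : List (Fin n), (u ++ v).Pairwise (· ≤ ·) → cnt (u ++ v) = a →
      T.HasPath (cnt u) v := by
  induction v with
  | nil => intro u _ _; trivial
  | cons o v ih =>
    intro u hs ha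
    obtain ⟨-, h2, h3⟩ := List.pairwise_append.1 hs
    have hcnt : ∀ i, a i = cnt u i + (e o i + cnt v i) := fun i => by
      rw [← ha, cnt_append, cnt_cons]; rfl
    refine ⟨hT.hasFace_boundary hθ ?_ (fun i hi => ?_) fun i hi => ?_, ?_⟩
    · rw [hcnt, e_self]; omega
    · have : cnt v i = 0 := List.count_eq_zero.2 fun hv =>
        hi.not_ge (List.rel_of_pairwise_cons h2 hv)
      rw [hcnt, e_ne hi.ne, this]; rfl
    · exact List.count_eq_zero.2 fun hu => hi.not_ge (h3 i hu o (by simp))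
    · have := ih (u ++ [o]) (by simpa using hs) (by simpa using ha)
      rwa [cnt_concat] at this

theorem Subcomplex.HasPath.onPath_subset {w : List (Fin n)} (h : T.HasPath 0 w) (ha : cnt w = a)
    (hne : w ≠ []) : OnPath w ⊆ T.vert := by
  rintro I ⟨u, v, rfl, rfl⟩
  rcases v with _ | ⟨o, v⟩
  · rcases List.eq_nil_or_concat u with rfl | ⟨u, o, rfl⟩
    · simp at hne
    · rw [List.append_nil, List.concat_eq_append] at h
      have := h.hasFace
      rw [List.concat_eq_append, cnt_concat]
      exact mem_vert_iff.2 (this.mono (fun i => by simp) fun i => by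
        rcases eq_or_ne i o with rfl | hi
        · simp [e_self]
        · simp [e_ne hi])
  · exact h.hasFace.start_mem_vert

variable {w₀ w : List (Fin n)} {A : Set (Fin n → ℕ)}

theorem Sweep.subset_vert (h : Sweep (fun I j k => T.HasFace I {j, k}) w₀ A w)
    (h₀ : OnPath w₀ ⊆ T.vert) : A ⊆ T.vert := by
  induction h with
  | base => exact h₀
  | step _ hF _ ih => exact Set.insert_subset hF.left_mem_vert ih

/-- A point is added only by a swap, and the vertex it replaces lay on the path before. This allows
visits to be traced from left vertices back to right vertices. -/
theorem Sweep.eq_left_or_mem {F : (Fin n → ℕ) → Fin n → Fin n → Prop} (h : Sweep F w₀ A w) :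
    ∀ I ∈ A, I ∈ OnPath w₀ ∨ ∃ J j k, j < k ∧ F J j k ∧ I = J + e k ∧ J + e j ∈ A := by
  induction h with
  | base => exact fun I hI => Or.inl hI
  | @step A u v j k hjk hF h ih =>
    intro I hI
    rcases hI with rfl | hI
    · exact Or.inr ⟨cnt u, j, k, hjk, hF, rfl, Set.mem_insert_of_mem _
        (h.onPath_subset ⟨u ++ [j], k :: v, by simp, cnt_concat _ _⟩)⟩
    · rcases ih I hI with h | ⟨J, j', k', h1, h2, h3, h4⟩
      · exact Or.inl h
      · exact Or.inr ⟨J, j', k', h1, h2, h3, Set.mem_insert_of_mem _ h4⟩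

/-- Points of the left boundary lie on the reversely sorted path. -/
theorem mem_onPath_of_antisorted {I : Fin n → ℕ} (hw : w.Pairwise (· ≥ ·)) (hI : I ≤ cnt w)
    (h : ∀ j k, j < k → 0 < I j → cnt w k ≤ I k) : I ∈ OnPath w := by
  obtain ⟨u, hu, rfl⟩ := exists_antisorted_cnt_eq I
  obtain ⟨v, hv, hcv⟩ := exists_antisorted_cnt_eq (cnt w - cnt u)
  have hcnt : cnt w = cnt (u ++ v) := by rw [cnt_append, hcv, add_tsub_cancel_of_le hI]
  have huv : (u ++ v).Pairwise (· ≥ ·) := by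
    refine List.pairwise_append.2 ⟨hu, hv, fun j hj k hk => ?_⟩
    by_contra hjk
    have h1 := h j k (not_le.1 hjk) (List.count_pos_iff.2 hj)
    have h2 : 0 < cnt v k := List.count_pos_iff.2 hk
    rw [hcv, Pi.sub_apply] at h2
    omega
  rw [(cnt_eq_iff_perm.1 hcnt).eq_of_pairwise' hw huv]
  exact onPath_append u v

/-- A sweep from the right to the left boundary visits all vertices of a tiling. -/
theorem Sweep.vert_subset (hT : T.IsTiling θ) (hθ : Angles θ)
    (h : Sweep (fun I j k => T.HasFace I {j, k}) w₀ A w) (h₀ : w₀.Pairwise (· ≤ ·))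
    (h₀a : cnt w₀ = a) (hw : w.Pairwise (· ≥ ·)) (I : Fin n → ℕ) (hI : I ∈ T.vert) : I ∈ A := by
  have hwa : cnt w = a := h.cnt_eq.trans h₀a
  by_cases hex : ∃ j k, j < k ∧ 0 < I j ∧ I k < a k
  · obtain ⟨j, k, hjk, hj, hk⟩ := hex
    obtain ⟨j', k', J, hjk', rfl, hF⟩ := hT.exists_rhombus_vertex hθ hI hjk hj hk
    -- Induction runs leftward: exchanging `j'` for the larger `k'` lowers this weighted sum.
    have hdec : ∑ i, (J + e k') i * (n - i : ℕ) < ∑ i, (J + e j') i * (n - i : ℕ) := by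
      have : ∀ x : Fin n, ∑ i, (J + e x) i * (n - i : ℕ) = ∑ i, J i * (n - i : ℕ) + (n - x) :=
        fun x => by simp [add_mul, Finset.sum_add_distrib, e, Pi.single_apply]
      rw [this, this]
      have := k'.isLt
      have : (j' : ℕ) < k' := hjk'
      omega
    have hleft := Sweep.vert_subset hT hθ h h₀ h₀a hw (J + e k') hF.left_mem_vert
    -- The left vertex is not on the sorted path, where no `k'` precedes a `j'`. So it was added by
    -- a swap, and by `left_unique` across this very rhombus, whose right vertex was therefore
    -- visited.
    rcases h.eq_left_or_mem _ hleft with hon | ⟨J', j, k, hlt, hF', heq, hmem⟩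
    · obtain ⟨u, v, rfl, hu⟩ := hon
      have h1 : k' ∈ u := List.count_pos_iff.1 (by
        have := congrFun hu k'
        rw [Pi.add_apply, e_self] at this
        change cnt u k' > 0
        omega)
      have h2 : j' ∈ v := List.count_pos_iff.1 (by
        have h3 := congrFun hu j'
        have h4 := congrFun h₀a j'
        have h5 := hF.lt (i := j') (by simp)
        rw [Pi.add_apply, e_ne hjk'.ne] at h3
        rw [cnt_append, Pi.add_apply] at h4
        change cnt v j' > 0
        omega)
      exact absurd ((List.pairwise_append.1 h₀).2.2 k' h1 j' h2) hjk'.not_ge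
    · obtain ⟨rfl, rfl⟩ := hT.left_unique hθ hjk' hlt hF hF' heq
      rwa [add_right_cancel heq]
  · refine h.onPath_subset (mem_onPath_of_antisorted hw ?_ fun j k hjk hj => ?_)
    · rw [hwa]
      intro i
      simpa using (Subcomplex.mem_vert_iff.1 hI).le i
    · rw [hwa]
      by_contra hlt
      exact hex ⟨j, k, hjk, hj, not_le.1 hlt⟩
termination_by ∑ i, I i * (n - i : ℕ)

/-- The vertices of a tiling are the points visited by a sweep from the right to the left
boundary. -/
theorem Subcomplex.IsTiling.exists_sweep (hT : T.IsTiling θ) (hθ : Angles θ) (ha : a ≠ 0) :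
    ∃ w₀ w₁, w₀.Pairwise (· ≤ ·) ∧ w₁.Pairwise (· ≥ ·) ∧ cnt w₀ = a ∧ cnt w₁ = a ∧
      Sweep (fun I j k => T.HasFace I {j, k}) w₀ T.vert w₁ := by
  obtain ⟨w₀, h₀, h₀a⟩ := exists_sorted_cnt_eq a
  have hp : T.HasPath 0 w₀ := by
    have := hT.hasPath_sorted hθ w₀ [] h₀ h₀a
    rwa [cnt_nil] at this
  obtain ⟨A, w₁, hs, h₁⟩ := hT.exists_sweep_of_sweep hθ .base hp h₀a
  have hsub := hs.subset_vert (hp.onPath_subset h₀a (by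
    rintro rfl
    exact ha (h₀a.symm.trans cnt_nil)))
  have hA : A = T.vert := hsub.antisymm fun I hI => hs.vert_subset hT hθ h₀ h₀a h₁ I hI
  exact ⟨w₀, w₁, h₀, h₁, h₀a, hs.cnt_eq.trans h₀a, hA ▸ hs⟩

end Sweeping

/-! ### The variables as units of the Laurent polynomial ring, and the conclusion. -/

section Laurent

variable {n : ℕ} {a : Fin n → ℕ} (T : Subcomplex a)

theorem Subcomplex.var_mem_laurent (J : T.vert) : T.var J ∈ T.laurent :=
  Algebra.subset_adjoin (Or.inl ⟨J, rfl⟩)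

theorem Subcomplex.inv_var_mem_laurent (J : T.vert) : (T.var J)⁻¹ ∈ T.laurent :=
  Algebra.subset_adjoin (Or.inr ⟨J, rfl⟩)

theorem Subcomplex.isUnit_var (J : T.vert) :
    IsUnit (⟨T.var J, T.var_mem_laurent J⟩ : T.laurent) :=
  IsUnit.of_mul_eq_one ⟨_, T.inv_var_mem_laurent J⟩
    (Subtype.ext (mul_inv_cancel₀ (isPositive_X J).ne_zero))

end Laurent

end CubeRecurrence

theorem proposition4p1 {n : ℕ} (hn : 3 ≤ n) (a : Fin n → ℕ) (ha : ∀ i, 0 < a i)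
    (θ : Fin n → ℝ) (hθ : StrictMono θ) (hθ_pos : ∀ i, 0 < θ i) (hθ_lt : ∀ i, θ i < Real.pi)
    (T₀ : CubeRecurrence.Subcomplex a) (hT₀ : T₀.IsTiling θ) :
    ∃ x : (Fin n → ℕ) → T₀.RatFunc,
      T₀.IsLabeling x ∧
      (∀ y : (Fin n → ℕ) → T₀.RatFunc, T₀.IsLabeling y → ∀ I, I ≤ a → y I = x I) ∧
      ∀ I, I ≤ a → x I ∈ T₀.laurent := by
  classical
  have ha0 : a ≠ 0 := fun h => (ha ⟨0, by omega⟩).ne' (congrFun h _)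
  obtain ⟨w₀, w₁, h₀, h₁, h₀a, h₁a, hs⟩ := hT₀.exists_sweep ⟨hθ, hθ_pos, hθ_lt⟩ ha0
  -- The extension is built over `T₀.laurent` itself, where the variables are units, so Laurentness
  -- is automatic; the value `0` off the vertices is never used.
  obtain ⟨x, hx, hrel⟩ := hs.exists_cubeRelations
    (fun I => if h : I ∈ T₀.vert then (⟨T₀.var ⟨I, h⟩, T₀.var_mem_laurent _⟩ : T₀.laurent) else 0)
    fun I hI => by rw [dif_pos hI]; exact T₀.isUnit_var ⟨I, hI⟩
  have hxvar : ∀ J : T₀.vert, (x J : T₀.RatFunc) = T₀.var J := fun J => by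
    rw [hx J J.2, dif_pos J.2]
  have hxrel : CubeRecurrence.CubeRelations a fun I => (x I : T₀.RatFunc) := by
    intro I j k l hjk hkl hle
    simpa using congrArg (fun z : T₀.laurent => (z : T₀.RatFunc))
      (hrel I j k l hjk hkl (h₀a ▸ hle))
  refine ⟨fun I => x I, ⟨hxvar, hxrel⟩, fun y hy I hI => ?_, fun I _ => (x I).2⟩
  -- On the vertices both labelings are the variables, which are positive, so the whole sweep lies
  -- in this set.
  obtain ⟨m, hm⟩ := hs.exists_good (D := {I | y I = x I ∧ CubeRecurrence.IsPositive
    (x I : T₀.RatFunc)}) fun J hJ => by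
      have := hxvar ⟨J, hJ⟩
      exact ⟨(hy.1 ⟨J, hJ⟩).trans this.symm, this ▸ CubeRecurrence.isPositive_X _⟩
  exact (hm.mem_of_le (CubeRecurrence.cubeClosed_agree hxrel hy.2) h₀ h₁ h₁a hI).1
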